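/- Let $\Bbbk$ be a commutative ring of characteristic not equal to two and let $z\in\Bbbk$. All categories are strict monoidal supercategories over $\Bbbk$, with super interchange law $(f'\otimes g)\circ(f\otimes g')=(-1)^{\bar f\bar g}(f'\circ f)\otimes(g\circ g')$, and "monoidal superfunctor" means strict monoidal superfunctor. **The quantum isomeric supercategory.** $\mathcal Q(z)$ is the strict monoidal supercategory generated by objects $\uparrow,\downarrow$ and morphisms $P,N\colon\uparrow\otimes\uparrow\to\uparrow\otimes\uparrow$ (positive and negative crossing), $R^-\colon\uparrow\otimes\downarrow\to\downarrow\otimes\uparrow$ (negative right crossing), $\varepsilon\colon\downarrow\otimes\uparrow\to\mathbf 1$ (left cap), $\eta\colon\mathbf 1\to\uparrow\otimes\downarrow$ (left cup), all even, and an odd $\tau\colon\uparrow\to\uparrow$ (closed Clifford token). Put, for $f=P,N$ respectively, $$L^{+},L^{-}:=(\varepsilon\otimes 1_\uparrow\otimes 1_\downarrow)(1_\downarrow\otimes f\otimes 1_\downarrow)(1_\downarrow\otimes 1_\uparrow\otimes\eta)\colon\ \downarrow\otimes\uparrow\to\uparrow\otimes\downarrow,$$ $\varepsilon':=\varepsilon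 R^-$ (right cap), $\eta':=R^-\eta$ (right cup), and $R^+:=R^-+z\,\eta'\varepsilon'$ (positive right crossing). The defining relations are $$NP=PN=1,\quad L^+R^-=1,\quad R^-L^+=1,\quad (P\otimes1)(1\otimes P)(P\otimes 1)=(1\otimes P)(P\otimes1)(1\otimes P),\quad P-N=z\,1,$$ $$\tau^2=-1_\uparrow,\quad P(\tau\otimes1_\uparrow)=(1_\uparrow\otimes\tau)P,\quad \varepsilon'(\tau\otimes1_\downarrow)\eta=0=\varepsilon'\eta,$$ $$(1_\uparrow\otimes\varepsilon)(\eta\otimes1_\uparrow)=1_\uparrow,\quad(\varepsilon\otimes1_\downarrow)(1_\downarrow\otimes\eta)=1_\downarrow.$$ **The affine version.** $\mathcal{AQ}(z)$ is obtained from $\mathcal Q(z)$ by adjoining an odd morphism $o\colon\uparrow\to\uparrow$ (open Clifford token) subject to $$o^2=-1_\uparrow,\qquad P(1_\uparrow\otimes o)=(o\otimes1_\uparrow)P,\qquad \varepsilon'(o\otimes1_\downarrow)\eta=0.$$ **Endosuperfunctors.** $\mathcal{SE}nd(\mathcal Q(z))$ is the strict monoidal supercategory of superfunctors $\mathcal Q(z)\to\mathcal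 Q(z)$ (tensor product being composition) and supernatural transformations, i.e. sums of families $\alpha_X\colon FX\to GX$ of parity $r\in\mathbb Z/2$ with $Gf\circ\alpha_X=(-1)^{r\bar f}\alpha_Y\circ Ff$ for homogeneous $f\colon X\to Y$. **Crossings.** For $X=X_1\otimes\dots\otimes X_m$ with $X_i\in\{\uparrow,\downarrow\}$ let $s_X\colon\uparrow\otimes X\to X\otimes\uparrow$ and $t_X\colon X\otimes\uparrow\to\uparrow\otimes X$ be the morphisms of $\mathcal Q(z)$ in which $X$ passes over $\uparrow$: $s_{\mathbf 1}=t_{\mathbf 1}=1_\uparrow$, $s_\uparrow=N$, $s_\downarrow=R^+$, $t_\uparrow=P$, $t_\downarrow=L^-$, and $s_{X_1\otimes X'}=(1_{X_1}\otimes s_{X'})(s_{X_1}\otimes1_{X'})$, $t_{X_1\otimes X'}=(t_{X_1}\otimes1_{X'})(1_{X_1}\otimes t_{X'})$. **Proposition.** There is a unique monoidal superfunctor $$\mathbf C\colon\mathcal{AQ}(z)\to\mathcal{SE}nd(\mathcal Q(z))$$ (the collapsing superfunctor) such that $\mathbf C(X)=X\otimes-$ for all objects $X$, $\mathbf C(f)=f\otimes-$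 for $f\in\{P,N,R^+,\varepsilon,\eta,\tau\}$, and $\mathbf C(o)$ is the supernatural transformation $\uparrow\otimes-\to\uparrow\otimes-$ with components $$\mathbf C(o)_X=t_X\circ(1_X\otimes\tau)\circ s_X .$$ Moreover $\mathbf C(R^-)=R^-\otimes-$, so that $\mathbf C(f)=f\otimes-$ for every generating morphism $f$ of $\mathcal Q(z)$. -/

import Mathlib

open CategoryTheory

noncomputable section

universe u v w v' w'

/-! # Supercategories, superfunctors and supernatural transformations -/

/-- The Koszul sign `(-1) ^ (p q)`. -/
def koszul (k : Type u) [CommRing k] (p q : ZMod 2) : k := (-1) ^ (p.val * q.val)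

theorem koszul_add_left {k : Type u} [CommRing k] (p q r : ZMod 2) :
    koszul k (p + q) r = koszul k p r * koszul k q r := by
  have h : ∀ p q r : ZMod 2,
      ((p + q).val * r.val) % 2 = (p.val * r.val + q.val * r.val) % 2 := by decide
  unfold koszul
  rw [← pow_add]
  exact neg_one_pow_congr (by simp only [Nat.even_iff, h])

theorem koszul_add_right {k : Type u} [CommRing k] (p q r : ZMod 2) :
    koszul k r (p + q) = koszul k r p * koszul k r q := by
  have h : ∀ p q : ZMod 2, koszul k p q = koszul k q p := fun p q => by
    unfold koszul; rw [mul_comm]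
  rw [h, koszul_add_left, h p, h q]

@[simp] theorem koszul_zero_left {k : Type u} [CommRing k] (q : ZMod 2) :
    koszul k 0 q = 1 := by simp [koszul]

@[simp] theorem koszul_zero_right {k : Type u} [CommRing k] (q : ZMod 2) :
    koszul k q 0 = 1 := by simp [koszul]

/-- A `k`-linear supercategory: a category whose morphism spaces are `k`-supermodules
`Hom(X, Y) = Hom(X, Y)₀ ⊕ Hom(X, Y)₁` and whose composition is bilinear and parity-preserving. -/
class Supercategory (k : Type u) [CommRing k] (C : Type w) [Category.{v} C] [Preadditive C]
    [Linear k C] where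
  /-- `part p X Y` is the submodule of morphisms of parity `p`. -/
  part : ZMod 2 → ∀ X Y : C, Submodule k (X ⟶ Y)
  isCompl : ∀ X Y : C, IsCompl (part 0 X Y) (part 1 X Y)
  id_mem : ∀ X : C, 𝟙 X ∈ part 0 X X
  comp_mem : ∀ {p q : ZMod 2} {X Y Z : C} {f : X ⟶ Y} {g : Y ⟶ Z},
    f ∈ part p X Y → g ∈ part q Y Z → f ≫ g ∈ part (p + q) X Z

namespace Supercategory

variable (k : Type u) [CommRing k] {C : Type w} [Category.{v} C] [Preadditive C] [Linear k C]
  [Supercategory k C]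

theorem exists_decomp {X Y : C} (f : X ⟶ Y) :
    ∃ f₀ ∈ part (k := k) 0 X Y, ∃ f₁ ∈ part (k := k) 1 X Y, f₀ + f₁ = f := by
  have h : f ∈ part (k := k) 0 X Y ⊔ part (k := k) 1 X Y := by
    rw [(isCompl X Y).sup_eq_top]; trivial
  exact Submodule.mem_sup.1 h

end Supercategory

/-- A superfunctor: a functor which is linear and parity-preserving on morphism spaces. -/
@[ext]
structure Superfunctor (k : Type u) [CommRing k]
    (A : Type w) [Category.{v} A] [Preadditive A] [Linear k A] [Supercategory k A]
    (B : Type w') [Category.{v'} B] [Preadditive B] [Linear k B] [Supercategory k B]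
    extends A ⥤ B where
  map_add' : ∀ {X Y : A} (f g : X ⟶ Y), map (f + g) = map f + map g
  map_smul' : ∀ {X Y : A} (r : k) (f : X ⟶ Y), map (r • f) = r • map f
  map_part : ∀ {p : ZMod 2} {X Y : A} {f : X ⟶ Y},
    f ∈ Supercategory.part (k := k) p X Y → map f ∈ Supercategory.part (k := k) p (obj X) (obj Y)

/-- A strict monoidal supercategory: the objects form a monoid under the tensor product
(written `X * Y`), and the tensor product of morphisms is bilinear, parity-preserving, strictly
associative and unital, and satisfies the super interchange law
`(f' ⊗ g) ∘ (f ⊗ g') = (-1) ^ (|f| |g|) (f' ∘ f) ⊗ (g ∘ g')`. -/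
class StrictMonoidalSupercategory (k : Type u) [CommRing k] (C : Type w) [Category.{v} C]
    [Preadditive C] [Linear k C] [Supercategory k C] [Monoid C] where
  tensor : ∀ {X Y X' Y' : C}, (X ⟶ Y) → (X' ⟶ Y') → (X * X' ⟶ Y * Y')
  add_tensor : ∀ {X Y X' Y' : C} (f₁ f₂ : X ⟶ Y) (g : X' ⟶ Y'),
    tensor (f₁ + f₂) g = tensor f₁ g + tensor f₂ g
  tensor_add : ∀ {X Y X' Y' : C} (f : X ⟶ Y) (g₁ g₂ : X' ⟶ Y'),
    tensor f (g₁ + g₂) = tensor f g₁ + tensor f g₂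
  smul_tensor : ∀ {X Y X' Y' : C} (r : k) (f : X ⟶ Y) (g : X' ⟶ Y'),
    tensor (r • f) g = r • tensor f g
  tensor_smul : ∀ {X Y X' Y' : C} (r : k) (f : X ⟶ Y) (g : X' ⟶ Y'),
    tensor f (r • g) = r • tensor f g
  tensor_mem : ∀ {p q : ZMod 2} {X Y X' Y' : C} {f : X ⟶ Y} {g : X' ⟶ Y'},
    f ∈ Supercategory.part (k := k) p X Y → g ∈ Supercategory.part (k := k) q X' Y' →
      tensor f g ∈ Supercategory.part (k := k) (p + q) (X * X') (Y * Y')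
  tensor_id : ∀ X Y : C, tensor (𝟙 X) (𝟙 Y) = 𝟙 (X * Y)
  interchange : ∀ {p q : ZMod 2} {X Y Z X' Y' Z' : C} {f : X ⟶ Y} (f' : Y ⟶ Z)
    (g' : X' ⟶ Y') {g : Y' ⟶ Z'},
    f ∈ Supercategory.part (k := k) p X Y → g ∈ Supercategory.part (k := k) q Y' Z' →
      tensor f g' ≫ tensor f' g = koszul k p q • tensor (f ≫ f') (g' ≫ g)
  tensor_assoc : ∀ {X Y X' Y' X'' Y'' : C} (f : X ⟶ Y) (g : X' ⟶ Y') (h : X'' ⟶ Y''),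
    tensor (tensor f g) h =
      eqToHom (mul_assoc X X' X'') ≫ tensor f (tensor g h) ≫ eqToHom (mul_assoc Y Y' Y'').symm
  one_tensor : ∀ {X Y : C} (f : X ⟶ Y),
    tensor (𝟙 (1 : C)) f = eqToHom (one_mul X) ≫ f ≫ eqToHom (one_mul Y).symm
  tensor_one : ∀ {X Y : C} (f : X ⟶ Y),
    tensor f (𝟙 (1 : C)) = eqToHom (mul_one X) ≫ f ≫ eqToHom (mul_one Y).symm

/-- A (strict) monoidal superfunctor between strict monoidal supercategories. -/
@[ext]
structure MonoidalSuperfunctor (k : Type u) [CommRing k]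
    (A : Type w) [Category.{v} A] [Preadditive A] [Linear k A] [Supercategory k A] [Monoid A]
    [StrictMonoidalSupercategory k A]
    (B : Type w') [Category.{v'} B] [Preadditive B] [Linear k B] [Supercategory k B] [Monoid B]
    [StrictMonoidalSupercategory k B]
    extends Superfunctor k A B where
  obj_one : obj 1 = 1
  obj_mul : ∀ X Y : A, obj (X * Y) = obj X * obj Y
  map_tensor : ∀ {X Y X' Y' : A} (f : X ⟶ Y) (g : X' ⟶ Y'),
    map (StrictMonoidalSupercategory.tensor (k := k) f g) =
      eqToHom (obj_mul X X') ≫ StrictMonoidalSupercategory.tensor (k := k) (map f) (map g) ≫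
        eqToHom (obj_mul Y Y').symm

/-! # The strict monoidal supercategory of endosuperfunctors -/

section SEnd

variable (k : Type u) [CommRing k]
  (A : Type w) [Category.{v} A] [Preadditive A] [Linear k A] [Supercategory k A]

/-- The superfunctors from `A` to itself. -/
def SEnd : Type (max v w) := Superfunctor k A A

variable {A}

/-- The families `α` of morphisms `α X : F X ⟶ G X` of parity `p` such that
`G f ∘ α X = (-1) ^ (p |f|) α Y ∘ F f` for every homogeneous `f : X ⟶ Y`: the supernatural
transformations of parity `p`. -/
def supernatPart (p : ZMod 2) (F G : SEnd k A) : Submodule k (∀ X : A, F.obj X ⟶ G.obj X) where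
  carrier := {α | (∀ X, α X ∈ Supercategory.part (k := k) p (F.obj X) (G.obj X)) ∧
    ∀ (q : ZMod 2) (X Y : A) (f : X ⟶ Y), f ∈ Supercategory.part (k := k) q X Y →
      α X ≫ G.map f = koszul k p q • (F.map f ≫ α Y)}
  add_mem' := by
    rintro α β ⟨hα, hα'⟩ ⟨hβ, hβ'⟩
    refine ⟨fun X => Submodule.add_mem _ (hα X) (hβ X), fun q X Y f hf => ?_⟩
    simp only [Pi.add_apply, Preadditive.add_comp, Preadditive.comp_add, smul_add,
      hα' q X Y f hf, hβ' q X Y f hf]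
  zero_mem' := ⟨fun X => Submodule.zero_mem _, fun q X Y f hf => by simp⟩
  smul_mem' := by
    rintro r α ⟨hα, hα'⟩
    refine ⟨fun X => Submodule.smul_mem _ _ (hα X), fun q X Y f hf => ?_⟩
    simp only [Pi.smul_apply, Linear.smul_comp, Linear.comp_smul, hα' q X Y f hf]
    rw [smul_comm]

/-- The supernatural transformations `F ⇒ G`: the sums `α₀ + α₁` of a supernatural transformation
`α₀` of parity `0` and a supernatural transformation `α₁` of parity `1`. -/
def supernat (F G : SEnd k A) : Submodule k (∀ X : A, F.obj X ⟶ G.obj X) :=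
  supernatPart k 0 F G ⊔ supernatPart k 1 F G

variable {k}

theorem supernatPart_le {F G : SEnd k A} (p : ZMod 2) :
    supernatPart k p F G ≤ supernat k F G := by
  have h : p = 0 ∨ p = 1 := by revert p; decide
  rcases h with rfl | rfl
  · exact le_sup_left
  · exact le_sup_right

theorem supernat_induction {F G : SEnd k A} {P : (∀ X : A, F.obj X ⟶ G.obj X) → Prop}
    (hP : ∀ p, ∀ α ∈ supernatPart k p F G, P α) (hadd : ∀ α β, P α → P β → P (α + β))
    {α : ∀ X : A, F.obj X ⟶ G.obj X} (h : α ∈ supernat k F G) : P α := by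
  obtain ⟨a, ha, b, hb, rfl⟩ := Submodule.mem_sup.1 h
  exact hadd _ _ (hP _ _ ha) (hP _ _ hb)

theorem id_mem_supernatPart (F : SEnd k A) :
    (fun X => 𝟙 (F.obj X)) ∈ supernatPart k 0 F F :=
  ⟨fun X => Supercategory.id_mem _, fun q X Y f hf => by simp⟩

theorem vcomp_mem_supernatPart {F G H : SEnd k A} {p q : ZMod 2}
    {α : ∀ X : A, F.obj X ⟶ G.obj X} {β : ∀ X : A, G.obj X ⟶ H.obj X}
    (hα : α ∈ supernatPart k p F G) (hβ : β ∈ supernatPart k q G H) :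
    (fun X => α X ≫ β X) ∈ supernatPart k (p + q) F H := by
  refine ⟨fun X => Supercategory.comp_mem (hα.1 X) (hβ.1 X), fun r X Y f hf => ?_⟩
  rw [Category.assoc, hβ.2 r X Y f hf, Linear.comp_smul, ← Category.assoc, hα.2 r X Y f hf,
    Linear.smul_comp, Category.assoc, smul_smul, koszul_add_left, mul_comm]

theorem vcomp_mem_supernat {F G H : SEnd k A}
    {α : ∀ X : A, F.obj X ⟶ G.obj X} {β : ∀ X : A, G.obj X ⟶ H.obj X}
    (hα : α ∈ supernat k F G) (hβ : β ∈ supernat k G H) :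
    (fun X => α X ≫ β X) ∈ supernat k F H := by
  refine supernat_induction (P := fun α => (fun X => α X ≫ β X) ∈ supernat k F H) ?_ ?_ hα
  · intro p α hα
    refine supernat_induction (P := fun β => (fun X => α X ≫ β X) ∈ supernat k F H) ?_ ?_ hβ
    · intro q β hβ
      exact supernatPart_le _ (vcomp_mem_supernatPart hα hβ)
    · intro β β' h h'
      simp only [Pi.add_apply, Preadditive.comp_add]
      exact Submodule.add_mem _ h h'
  · intro α α' h h'
    simp only [Pi.add_apply, Preadditive.add_comp]
    exact Submodule.add_mem _ h h'

variable (k A) in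
/-- Vertical composition is componentwise. -/
instance : Category.{max v w} (SEnd k A) where
  Hom F G := supernat k F G
  id F := ⟨fun X => 𝟙 (F.obj X), supernatPart_le _ (id_mem_supernatPart F)⟩
  comp α β := ⟨fun X => α.1 X ≫ β.1 X, vcomp_mem_supernat α.2 β.2⟩
  id_comp _ := Subtype.ext (funext fun _ => Category.id_comp _)
  comp_id _ := Subtype.ext (funext fun _ => Category.comp_id _)
  assoc _ _ _ := Subtype.ext (funext fun _ => Category.assoc _ _ _)

/-- The component at `X` of a supernatural transformation. -/
def SEnd.app {F G : SEnd k A} (α : F ⟶ G) (X : A) : F.obj X ⟶ G.obj X := α.1 X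

instance : Preadditive (SEnd k A) where
  homGroup F G := inferInstanceAs (AddCommGroup (supernat k F G))
  add_comp _ _ _ _ _ _ := Subtype.ext (funext fun _ => Preadditive.add_comp _ _ _ _ _ _)
  comp_add _ _ _ _ _ _ := Subtype.ext (funext fun _ => Preadditive.comp_add _ _ _ _ _ _)

instance : Linear k (SEnd k A) where
  homModule F G := inferInstanceAs (Module k (supernat k F G))
  smul_comp _ _ _ _ _ _ := Subtype.ext (funext fun _ => Linear.smul_comp _ _ _ _ _ _)
  comp_smul _ _ _ _ _ _ := Subtype.ext (funext fun _ => Linear.comp_smul _ _ _ _ _ _)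

instance : Supercategory k (SEnd k A) where
  part p F G := (supernatPart k p F G).comap (supernat k F G).subtype
  isCompl F G := by
    refine ⟨Submodule.disjoint_def.2 ?_, codisjoint_iff.2 ?_⟩
    · intro α h₀ h₁
      refine Subtype.ext (funext fun X => ?_)
      exact Submodule.disjoint_def.1 (Supercategory.isCompl (k := k) (F.obj X) (G.obj X)).1 _
        (h₀.1 X) (h₁.1 X)
    · refine eq_top_iff.2 fun α _ => ?_
      obtain ⟨a, ha, b, hb, hab⟩ := Submodule.mem_sup.1 α.2
      exact Submodule.mem_sup.2 ⟨⟨a, supernatPart_le _ ha⟩, ha, ⟨b, supernatPart_le _ hb⟩, hb,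
        Subtype.ext hab⟩
  id_mem F := id_mem_supernatPart F
  comp_mem h h' := vcomp_mem_supernatPart h h'

/-- The tensor product `F * G` of endosuperfunctors is the composite `F ∘ G`. -/
instance : Monoid (SEnd k A) where
  mul F G :=
    { toFunctor := G.toFunctor ⋙ F.toFunctor
      map_add' := fun f g => by
        simp only [Functor.comp_map]; rw [G.map_add', F.map_add']
      map_smul' := fun r f => by
        simp only [Functor.comp_map]; rw [G.map_smul', F.map_smul']
      map_part := fun h => F.map_part (G.map_part h) }
  one :=
    { toFunctor := 𝟭 A
      map_add' := fun _ _ => rfl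
      map_smul' := fun _ _ => rfl
      map_part := fun h => h }
  mul_assoc _ _ _ := rfl
  one_mul _ := rfl
  mul_one _ := rfl

/-- The horizontal composite of `β : H ⇒ K` and `α : F ⇒ G`, from `H ∘ F` to `K ∘ G`: its component
at `X` is `β (G X) ∘ H (α X)`. -/
def hcompFun {H K F G : SEnd k A} (β : ∀ X : A, H.obj X ⟶ K.obj X)
    (α : ∀ X : A, F.obj X ⟶ G.obj X) (X : A) : (H * F).obj X ⟶ (K * G).obj X :=
  H.map (α X) ≫ β (G.obj X)

theorem hcomp_mem_supernatPart {H K F G : SEnd k A} {p q : ZMod 2}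
    {β : ∀ X : A, H.obj X ⟶ K.obj X} {α : ∀ X : A, F.obj X ⟶ G.obj X}
    (hβ : β ∈ supernatPart k p H K) (hα : α ∈ supernatPart k q F G) :
    hcompFun β α ∈ supernatPart k (p + q) (H * F) (K * G) := by
  refine ⟨fun X => ?_, fun r X Y f hf => ?_⟩
  · rw [add_comm]
    exact Supercategory.comp_mem (H.map_part (hα.1 X)) (hβ.1 (G.obj X))
  · change (H.map (α X) ≫ β (G.obj X)) ≫ K.map (G.map f) =
      koszul k (p + q) r • (H.map (F.map f) ≫ H.map (α Y) ≫ β (G.obj Y))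
    rw [Category.assoc, hβ.2 r _ _ _ (G.map_part hf), Linear.comp_smul, ← Category.assoc,
      ← H.map_comp, hα.2 r X Y f hf, H.map_smul', H.map_comp, Linear.smul_comp, Category.assoc,
      smul_smul, koszul_add_left]

theorem hcomp_mem_supernat {H K F G : SEnd k A}
    {β : ∀ X : A, H.obj X ⟶ K.obj X} {α : ∀ X : A, F.obj X ⟶ G.obj X}
    (hβ : β ∈ supernat k H K) (hα : α ∈ supernat k F G) :
    hcompFun β α ∈ supernat k (H * F) (K * G) := by
  refine supernat_induction (P := fun β => hcompFun β α ∈ supernat k (H * F) (K * G)) ?_ ?_ hβ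
  · intro p β hβ
    refine supernat_induction (P := fun α => hcompFun β α ∈ supernat k (H * F) (K * G)) ?_ ?_ hα
    · intro q α hα
      exact supernatPart_le _ (hcomp_mem_supernatPart hβ hα)
    · intro α α' h h'
      have e : hcompFun β (α + α') = hcompFun β α + hcompFun β α' := by
        funext X
        simp only [hcompFun, Pi.add_apply, H.map_add', Preadditive.add_comp]
      rw [e]
      exact Submodule.add_mem _ h h'
  · intro β β' h h'
    have e : hcompFun (β + β') α = hcompFun β α + hcompFun β' α := by
      funext X
      simp only [hcompFun, Pi.add_apply, Preadditive.comp_add]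
    rw [e]
    exact Submodule.add_mem _ h h'

instance : StrictMonoidalSupercategory k (SEnd k A) where
  tensor β α := ⟨hcompFun β.1 α.1, hcomp_mem_supernat β.2 α.2⟩
  add_tensor _ _ _ := Subtype.ext (funext fun _ => Preadditive.comp_add _ _ _ _ _ _)
  tensor_add {H _ _ _} _ _ _ := Subtype.ext (funext fun _ =>
    (congrArg (· ≫ _) (H.map_add' _ _)).trans (Preadditive.add_comp _ _ _ _ _ _))
  smul_tensor _ _ _ := Subtype.ext (funext fun _ => Linear.comp_smul _ _ _ _ _ _)
  tensor_smul {H _ _ _} _ _ _ := Subtype.ext (funext fun _ =>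
    (congrArg (· ≫ _) (H.map_smul' _ _)).trans (Linear.smul_comp _ _ _ _ _ _))
  tensor_mem h h' := hcomp_mem_supernatPart h h'
  tensor_id F G := Subtype.ext (funext fun X => by
    change F.map (𝟙 (G.obj X)) ≫ 𝟙 (F.obj (G.obj X)) = 𝟙 _
    simp)
  interchange {p q F₁ F₂ F₃ G₁ G₂ G₃ f} f' g' {g} hf hg := Subtype.ext (funext fun X => by
    change (F₁.map (g'.1 X) ≫ f.1 (G₂.obj X)) ≫ F₂.map (g.1 X) ≫ f'.1 (G₃.obj X) =
      koszul k p q • (F₁.map (g'.1 X ≫ g.1 X) ≫ f.1 (G₃.obj X) ≫ f'.1 (G₃.obj X))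
    have h := hf.2 q _ _ (g.1 X) (hg.1 X)
    change f.1 (G₂.obj X) ≫ F₂.map (g.1 X) = koszul k p q • (F₁.map (g.1 X) ≫ f.1 (G₃.obj X)) at h
    rw [Category.assoc, ← Category.assoc (f.1 _), h]
    simp)
  tensor_assoc {F F' G G' H H'} f g h := by
    refine Subtype.ext (funext fun X => ?_)
    change F.map (G.map (h.1 X)) ≫ (F.map (g.1 (H'.obj X)) ≫ f.1 (G'.obj (H'.obj X))) =
      𝟙 _ ≫ (F.map (G.map (h.1 X) ≫ g.1 (H'.obj X)) ≫ f.1 (G'.obj (H'.obj X))) ≫ 𝟙 _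
    simp
  one_tensor {F G} f := by
    refine Subtype.ext (funext fun X => ?_)
    change f.1 X ≫ 𝟙 _ = 𝟙 _ ≫ f.1 X ≫ 𝟙 _
    simp
  tensor_one {F G} f := by
    refine Subtype.ext (funext fun X => ?_)
    change F.map (𝟙 _) ≫ f.1 X = 𝟙 _ ≫ f.1 X ≫ 𝟙 _
    simp

end SEnd

/-! # The superfunctors `X ⊗ -` and the supernatural transformations `f ⊗ -` -/

section TensorLeft

open StrictMonoidalSupercategory

variable (k : Type u) [CommRing k]
  {A : Type w} [Category.{v} A] [Preadditive A] [Linear k A] [Supercategory k A] [Monoid A]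
  [StrictMonoidalSupercategory k A]

theorem tensor_comp_id_left {X Y Z W : A} (f : Y ⟶ Z) (g : Z ⟶ W) :
    tensor (k := k) (𝟙 X) (f ≫ g) = tensor (k := k) (𝟙 X) f ≫ tensor (k := k) (𝟙 X) g := by
  obtain ⟨g₀, h₀, g₁, h₁, rfl⟩ := Supercategory.exists_decomp k g
  have e₀ := interchange (k := k) (𝟙 X) f (Supercategory.id_mem X) h₀
  have e₁ := interchange (k := k) (𝟙 X) f (Supercategory.id_mem X) h₁
  simp only [koszul_zero_left, one_smul, Category.comp_id] at e₀ e₁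
  simp only [Preadditive.comp_add, tensor_add, e₀, e₁]

/-- The superfunctor `X ⊗ -`. -/
def tensorLeftFunctor (X : A) : SEnd k A :=
  { obj := fun Y => X * Y
    map := fun g => tensor (k := k) (𝟙 X) g
    map_id := fun Y => tensor_id X Y
    map_comp := fun f g => tensor_comp_id_left k f g
    map_add' := fun f g => tensor_add _ f g
    map_smul' := fun r f => tensor_smul r _ f
    map_part := fun {p} _ _ _ h => by
      have := tensor_mem (Supercategory.id_mem X) h
      rwa [zero_add] at this }

theorem tensorLeft_mem_supernatPart {X Y : A} {p : ZMod 2} {f : X ⟶ Y}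
    (hf : f ∈ Supercategory.part (k := k) p X Y) :
    (fun Z => tensor (k := k) f (𝟙 Z)) ∈
      supernatPart k p (tensorLeftFunctor k X) (tensorLeftFunctor k Y) := by
  refine ⟨fun Z => ?_, fun q Z W g hg => ?_⟩
  · have := tensor_mem hf (Supercategory.id_mem (k := k) Z)
    rwa [add_zero] at this
  · change tensor (k := k) f (𝟙 Z) ≫ tensor (k := k) (𝟙 Y) g =
      koszul k p q • (tensor (k := k) (𝟙 X) g ≫ tensor (k := k) f (𝟙 W))
    rw [interchange (𝟙 Y) (𝟙 Z) hf hg,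
      interchange (p := 0) (q := 0) f g (Supercategory.id_mem X) (Supercategory.id_mem W)]
    simp

/-- The supernatural transformation `f ⊗ - : X ⊗ - ⇒ Y ⊗ -`, with component `f ⊗ 1_Z` at `Z`. -/
def tensorLeftMap {X Y : A} (f : X ⟶ Y) : tensorLeftFunctor k X ⟶ tensorLeftFunctor k Y :=
  ⟨fun Z => tensor (k := k) f (𝟙 Z), by
    obtain ⟨f₀, h₀, f₁, h₁, rfl⟩ := Supercategory.exists_decomp k f
    have e : (fun Z => tensor (k := k) (f₀ + f₁) (𝟙 Z)) =
        (fun Z => tensor (k := k) f₀ (𝟙 Z)) + fun Z => tensor (k := k) f₁ (𝟙 Z) := by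
      funext Z; exact add_tensor _ _ _
    rw [e]
    exact Submodule.add_mem _ (supernatPart_le _ (tensorLeft_mem_supernatPart k h₀))
      (supernatPart_le _ (tensorLeft_mem_supernatPart k h₁))⟩

end TensorLeft

/-! # Formal string diagrams -/

/-- The two generating objects `↑` and `↓`. -/
inductive Strand : Type
  | up
  | dn

open Strand

/-- The generating morphisms. Objects are words in `↑` and `↓`, the empty word being the unit
object. For `aff = false` these are the generators of the quantum isomeric supercategory; for
`aff = true` there is in addition the open Clifford token. -/
inductive Gen (aff : Bool) : List Strand → List Strand → Type
  /-- the positive crossing `↑ ⊗ ↑ → ↑ ⊗ ↑`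
  (the strand from bottom left to top right is the over-strand) -/
  | posUp : Gen aff [up, up] [up, up]
  /-- the negative crossing `↑ ⊗ ↑ → ↑ ⊗ ↑`
  (the strand from bottom right to top left is the over-strand) -/
  | negUp : Gen aff [up, up] [up, up]
  /-- the negative crossing `↑ ⊗ ↓ → ↓ ⊗ ↑` (the upward strand is the over-strand) -/
  | negRight : Gen aff [up, dn] [dn, up]
  /-- the left cap `↓ ⊗ ↑ → 𝟙` -/
  | capLeft : Gen aff [dn, up] []
  /-- the left cup `𝟙 → ↑ ⊗ ↓` -/
  | cupLeft : Gen aff [] [up, dn]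
  /-- the closed Clifford token `↑ → ↑` -/
  | token : Gen aff [up] [up]
  /-- the open Clifford token `↑ → ↑` -/
  | openToken : aff = true → Gen aff [up] [up]

/-- The Clifford tokens are odd, all other generators are even. -/
def Gen.parity {aff : Bool} : ∀ {X Y : List Strand}, Gen aff X Y → ZMod 2
  | _, _, .token => 1
  | _, _, .openToken _ => 1
  | _, _, _ => 0

/-- Formal diagrams built from the generators by vertical and horizontal composition.
`comp f g` is `f` followed by `g`, that is, `g` drawn above `f`;
`tens f g` is `f ⊗ g`, that is, `f` drawn to the left of `g`. -/
inductive Diagram (aff : Bool) : List Strand → List Strand → Type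
  | gen {X Y : List Strand} (g : Gen aff X Y) : Diagram aff X Y
  | id (X : List Strand) : Diagram aff X X
  | comp {X Y Z : List Strand} (f : Diagram aff X Y) (g : Diagram aff Y Z) : Diagram aff X Z
  | tens {X Y X' Y' : List Strand} (f : Diagram aff X Y) (g : Diagram aff X' Y') :
      Diagram aff (X ++ X') (Y ++ Y')

namespace Diagram

variable {aff : Bool}

def parity : ∀ {X Y : List Strand}, Diagram aff X Y → ZMod 2
  | _, _, gen g => g.parity
  | _, _, id _ => 0
  | _, _, comp f g => f.parity + g.parity
  | _, _, tens f g => f.parity + g.parity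

/-- Transport of a diagram along equalities of its source and target. -/
def cast {X X' Y Y' : List Strand} (hX : X = X') (hY : Y = Y') (f : Diagram aff X Y) :
    Diagram aff X' Y' :=
  hX ▸ hY ▸ f

theorem parity_cast {X X' Y Y' : List Strand} (hX : X = X') (hY : Y = Y')
    (f : Diagram aff X Y) : (f.cast hX hY).parity = f.parity := by
  subst hX; subst hY; rfl

abbrev posUp : Diagram aff [up, up] [up, up] := gen .posUp
abbrev negUp : Diagram aff [up, up] [up, up] := gen .negUp
abbrev negRight : Diagram aff [up, dn] [dn, up] := gen .negRight
abbrev capLeft : Diagram aff [dn, up] [] := gen .capLeft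
abbrev cupLeft : Diagram aff [] [up, dn] := gen .cupLeft
abbrev token : Diagram aff [up] [up] := gen .token
abbrev openToken : Diagram true [up] [up] := gen (.openToken rfl)

/-- The rotation `↓ ⊗ ↑ → ↑ ⊗ ↓` of an endomorphism of `↑ ⊗ ↑` through a left cup and cap. -/
abbrev rotate (f : Diagram aff [up, up] [up, up]) : Diagram aff [dn, up] [up, dn] :=
  comp (tens (id [dn, up]) cupLeft :)
    (comp (tens (id [dn]) (tens f (id [dn]) :) :) (tens capLeft (id [up, dn]) :))

/-- The positive crossing `↓ ⊗ ↑ → ↑ ⊗ ↓` (the upward strand is the over-strand). -/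
abbrev posLeft : Diagram aff [dn, up] [up, dn] := rotate posUp

/-- The negative crossing `↓ ⊗ ↑ → ↑ ⊗ ↓` (the downward strand is the over-strand). -/
abbrev negLeft : Diagram aff [dn, up] [up, dn] := rotate negUp

/-- The right cap `↑ ⊗ ↓ → 𝟙`. -/
abbrev capRight : Diagram aff [up, dn] [] := comp negRight capLeft

/-- The right cup `𝟙 → ↓ ⊗ ↑`. -/
abbrev cupRight : Diagram aff [] [dn, up] := comp cupLeft negRight

end Diagram

/-! # The defining relations -/

section Relations

open Diagram

variable {k : Type u} [CommRing k]

/-- Formal `k`-linear combinations of formal diagrams. -/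
abbrev LinDiagram (k : Type u) [CommRing k] (aff : Bool) (X Y : List Strand) : Type u :=
  Diagram aff X Y →₀ k

/-- A diagram as a linear combination of diagrams. -/
abbrev lin (k : Type u) [CommRing k] {aff : Bool} {X Y : List Strand} (f : Diagram aff X Y) :
    LinDiagram k aff X Y :=
  Finsupp.single f 1

/-- The defining relations `l = r` of the quantum isomeric supercategory and, for `aff = true`,
of the quantum affine isomeric supercategory. -/
inductive DefRel (z : k) : ∀ (aff : Bool) {X Y : List Strand},
    LinDiagram k aff X Y → LinDiagram k aff X Y → Prop
  | pos_neg (aff) : DefRel z aff (lin k (comp posUp negUp)) (lin k (id [up, up]))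
  | neg_pos (aff) : DefRel z aff (lin k (comp negUp posUp)) (lin k (id [up, up]))
  | right_left (aff) : DefRel z aff (lin k (comp negRight posLeft)) (lin k (id [up, dn]))
  | left_right (aff) : DefRel z aff (lin k (comp posLeft negRight)) (lin k (id [dn, up]))
  | braid (aff) : DefRel z aff
      (lin k (comp (tens posUp (id [up]) :)
        (comp (tens (id [up]) posUp :) (tens posUp (id [up]) :))))
      (lin k (comp (tens (id [up]) posUp :)
        (comp (tens posUp (id [up]) :) (tens (id [up]) posUp :))))
  | skein (aff) : DefRel z aff (lin k posUp - lin k negUp) (z • lin k (id [up, up]))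
  | token_sq (aff) : DefRel z aff (lin k (comp token token)) (-lin k (id [up]))
  | token_over (aff) : DefRel z aff (lin k (comp (tens token (id [up]) :) posUp))
      (lin k (comp posUp (tens (id [up]) token :)))
  | token_bubble (aff) :
      DefRel z aff (lin k (comp cupLeft (comp (tens token (id [dn]) :) capRight))) 0
  | bubble (aff) : DefRel z aff (lin k (comp cupLeft capRight)) 0
  | zigzag_up (aff) : DefRel z aff
      (lin k (comp (tens cupLeft (id [up]) :) (tens (id [up]) capLeft :))) (lin k (id [up]))
  | zigzag_dn (aff) : DefRel z aff
      (lin k (comp (tens (id [dn]) cupLeft :) (tens capLeft (id [dn]) :))) (lin k (id [dn]))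
  | open_sq : DefRel z true (lin k (comp openToken openToken)) (-lin k (id [up]))
  | open_under : DefRel z true (lin k (comp (tens (id [up]) openToken :) posUp))
      (lin k (comp posUp (tens openToken (id [up]) :)))
  | open_bubble :
      DefRel z true (lin k (comp cupLeft (comp (tens openToken (id [dn]) :) capRight))) 0

/-- The smallest family of submodules of linear combinations of diagrams that contains `l - r` for
every defining relation `l = r` and every axiom `l = r` of a strict monoidal supercategory, and
that is closed under horizontal and vertical composition with diagrams. -/
inductive Vanishes (z : k) (aff : Bool) : ∀ {X Y : List Strand}, LinDiagram k aff X Y → Prop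
  | zero {X Y : List Strand} : Vanishes z aff (0 : LinDiagram k aff X Y)
  | add {X Y : List Strand} {l m : LinDiagram k aff X Y} :
      Vanishes z aff l → Vanishes z aff m → Vanishes z aff (l + m)
  | smul {X Y : List Strand} (c : k) {l : LinDiagram k aff X Y} :
      Vanishes z aff l → Vanishes z aff (c • l)
  | comp_left {X Y Z : List Strand} (f : Diagram aff X Y) {l : LinDiagram k aff Y Z} :
      Vanishes z aff l → Vanishes z aff (l.mapDomain fun g => comp f g)
  | comp_right {X Y Z : List Strand} (g : Diagram aff Y Z) {l : LinDiagram k aff X Y} :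
      Vanishes z aff l → Vanishes z aff (l.mapDomain fun f => comp f g)
  | tens_left {X Y X' Y' : List Strand} (f : Diagram aff X Y) {l : LinDiagram k aff X' Y'} :
      Vanishes z aff l → Vanishes z aff (l.mapDomain fun g => tens f g)
  | tens_right {X Y X' Y' : List Strand} (g : Diagram aff X' Y') {l : LinDiagram k aff X Y} :
      Vanishes z aff l → Vanishes z aff (l.mapDomain fun f => tens f g)
  | id_comp {X Y : List Strand} (f : Diagram aff X Y) :
      Vanishes z aff (lin k (comp (id X) f) - lin k f)
  | comp_id {X Y : List Strand} (f : Diagram aff X Y) :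
      Vanishes z aff (lin k (comp f (id Y)) - lin k f)
  | comp_assoc {X Y Z W : List Strand} (f : Diagram aff X Y) (g : Diagram aff Y Z)
      (h : Diagram aff Z W) :
      Vanishes z aff (lin k (comp (comp f g) h) - lin k (comp f (comp g h)))
  | tens_id (X Y : List Strand) :
      Vanishes z aff (lin k (tens (id X) (id Y)) - lin k (id (X ++ Y)))
  | interchange {X Y Z X' Y' Z' : List Strand} (f : Diagram aff X Y) (f' : Diagram aff Y Z)
      (g' : Diagram aff X' Y') (g : Diagram aff Y' Z') :
      Vanishes z aff (lin k (comp (tens f g') (tens f' g)) -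
        koszul k f.parity g.parity • lin k (tens (comp f f') (comp g' g)))
  | tens_assoc {X Y X' Y' X'' Y'' : List Strand} (f : Diagram aff X Y) (g : Diagram aff X' Y')
      (h : Diagram aff X'' Y'') :
      Vanishes z aff (lin k ((tens (tens f g) h).cast (List.append_assoc X X' X'')
        (List.append_assoc Y Y' Y'')) - lin k (tens f (tens g h)))
  | one_tens {X Y : List Strand} (f : Diagram aff X Y) :
      Vanishes z aff (lin k ((tens (id []) f).cast (List.nil_append X) (List.nil_append Y)) -
        lin k f)
  | tens_one {X Y : List Strand} (f : Diagram aff X Y) :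
      Vanishes z aff (lin k ((tens f (id [])).cast (List.append_nil X) (List.append_nil Y)) -
        lin k f)
  | rel {X Y : List Strand} {l r : LinDiagram k aff X Y} :
      DefRel z aff l r → Vanishes z aff (l - r)

/-- The submodule of linear combinations of diagrams that are set equal to zero. -/
def vanishing (z : k) (aff : Bool) (X Y : List Strand) : Submodule k (LinDiagram k aff X Y) where
  carrier := {l | Vanishes z aff l}
  add_mem' := Vanishes.add
  zero_mem' := Vanishes.zero
  smul_mem' c _ := Vanishes.smul c

/-- Linear combinations of diagrams of parity `p`. -/
def linPart (k : Type u) [CommRing k] (aff : Bool) (p : ZMod 2) (X Y : List Strand) :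
    Submodule k (LinDiagram k aff X Y) :=
  Finsupp.supported k k {f | f.parity = p}

/-! ## The vanishing submodules are homogeneous -/

section Homogeneous

variable {aff : Bool}

theorem lin_mem {X Y : List Strand} {p : ZMod 2} {f : Diagram aff X Y} (h : f.parity = p) :
    lin k f ∈ linPart k aff p X Y :=
  Finsupp.single_mem_supported k 1 h

theorem filter_of_mem {X Y : List Strand} {p q : ZMod 2} {l : LinDiagram k aff X Y}
    (h : l ∈ linPart k aff q X Y) :
    l.filter (fun f => f.parity = p) = if p = q then l else 0 := by
  have h' : ∀ f, l f ≠ 0 → f.parity = q := fun f hf =>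
    (Finsupp.mem_supported k l).1 h (Finsupp.mem_support_iff.2 hf)
  split_ifs with e
  · subst e
    exact (Finsupp.filter_eq_self_iff _ _).2 h'
  · refine (Finsupp.filter_eq_zero_iff _ _).2 fun f hf => ?_
    by_contra h0
    exact e (hf.symm.trans (h' f h0))

theorem DefRel.homogeneous {z : k} {X Y : List Strand} {l r : LinDiagram k aff X Y}
    (h : DefRel z aff l r) : ∃ p, l ∈ linPart k aff p X Y ∧ r ∈ linPart k aff p X Y := by
  cases h with
  | skein => exact ⟨0, Submodule.sub_mem _ (lin_mem rfl) (lin_mem rfl),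
      Submodule.smul_mem _ _ (lin_mem rfl)⟩
  | token_sq => exact ⟨0, lin_mem rfl, Submodule.neg_mem _ (lin_mem rfl)⟩
  | open_sq => exact ⟨0, lin_mem rfl, Submodule.neg_mem _ (lin_mem rfl)⟩
  | token_over => exact ⟨1, lin_mem rfl, lin_mem rfl⟩
  | open_under => exact ⟨1, lin_mem rfl, lin_mem rfl⟩
  | token_bubble => exact ⟨1, lin_mem rfl, Submodule.zero_mem _⟩
  | open_bubble => exact ⟨1, lin_mem rfl, Submodule.zero_mem _⟩
  | bubble => exact ⟨0, lin_mem rfl, Submodule.zero_mem _⟩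
  | _ => exact ⟨0, lin_mem rfl, lin_mem rfl⟩

theorem filter_vanishes_of_mem {z : k} {X Y : List Strand} {l : LinDiagram k aff X Y}
    (h : Vanishes z aff l) {q : ZMod 2} (hl : l ∈ linPart k aff q X Y) (p : ZMod 2) :
    Vanishes z aff (l.filter fun f => f.parity = p) := by
  rw [filter_of_mem hl]
  split_ifs
  · exact h
  · exact .zero

theorem filter_mapDomain {X Y X' Y' : List Strand} (F : Diagram aff X Y → Diagram aff X' Y')
    (q : ZMod 2) (hF : ∀ f, (F f).parity = q + f.parity) (p : ZMod 2)
    (l : LinDiagram k aff X Y) :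
    (l.mapDomain F).filter (fun f => f.parity = p) =
      (l.filter fun f => f.parity = p - q).mapDomain F := by
  induction l using Finsupp.induction_linear with
  | zero => simp [Finsupp.filter_zero]
  | add l m hl hm =>
    rw [Finsupp.mapDomain_add, Finsupp.filter_add, Finsupp.filter_add, Finsupp.mapDomain_add,
      hl, hm]
  | single f c =>
    rw [Finsupp.mapDomain_single]
    by_cases h : f.parity = p - q
    · have h' : (F f).parity = p := by rw [hF, h]; ring
      rw [Finsupp.filter_single_of_pos (fun f : Diagram aff X' Y' => f.parity = p) h',
        Finsupp.filter_single_of_pos (fun f : Diagram aff X Y => f.parity = p - q) h, Finsupp.mapDomain_single]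
    · have h' : ¬(F f).parity = p := by rw [hF]; intro e; exact h (by rw [← e]; ring)
      rw [Finsupp.filter_single_of_neg (fun f : Diagram aff X' Y' => f.parity = p) h',
        Finsupp.filter_single_of_neg (fun f : Diagram aff X Y => f.parity = p - q) h, Finsupp.mapDomain_zero]

theorem Vanishes.filter {z : k} {X Y : List Strand} {l : LinDiagram k aff X Y}
    (h : Vanishes z aff l) : ∀ p : ZMod 2, Vanishes z aff (l.filter fun f => f.parity = p) := by
  induction h with
  | zero => intro p; rw [Finsupp.filter_zero]; exact .zero
  | add _ _ h₁ h₂ => intro p; rw [Finsupp.filter_add]; exact .add (h₁ p) (h₂ p)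
  | smul c _ h => intro p; rw [Finsupp.filter_smul]; exact .smul c (h p)
  | comp_left f _ h =>
    intro p
    rw [filter_mapDomain _ f.parity fun g => rfl]
    exact .comp_left f (h _)
  | comp_right g _ h =>
    intro p
    rw [filter_mapDomain _ g.parity fun f => add_comm _ _]
    exact .comp_right g (h _)
  | tens_left f _ h =>
    intro p
    rw [filter_mapDomain _ f.parity fun g => rfl]
    exact .tens_left f (h _)
  | tens_right g _ h =>
    intro p
    rw [filter_mapDomain _ g.parity fun f => add_comm _ _]
    exact .tens_right g (h _)
  | id_comp f =>
    exact filter_vanishes_of_mem (.id_comp f) (q := f.parity)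
      (Submodule.sub_mem _ (lin_mem (zero_add _)) (lin_mem rfl))
  | comp_id f =>
    exact filter_vanishes_of_mem (.comp_id f) (q := f.parity)
      (Submodule.sub_mem _ (lin_mem (add_zero _)) (lin_mem rfl))
  | comp_assoc f g h =>
    exact filter_vanishes_of_mem (.comp_assoc f g h) (q := f.parity + (g.parity + h.parity))
      (Submodule.sub_mem _ (lin_mem (add_assoc _ _ _)) (lin_mem rfl))
  | tens_id X Y =>
    exact filter_vanishes_of_mem (.tens_id X Y) (q := 0)
      (Submodule.sub_mem _ (lin_mem (add_zero _)) (lin_mem rfl))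
  | interchange f f' g' g =>
    exact filter_vanishes_of_mem (.interchange f f' g' g)
      (q := (f.parity + f'.parity) + (g'.parity + g.parity))
      (Submodule.sub_mem _ (lin_mem (add_add_add_comm _ _ _ _))
        (Submodule.smul_mem _ _ (lin_mem rfl)))
  | tens_assoc f g h =>
    exact filter_vanishes_of_mem (.tens_assoc f g h) (q := f.parity + (g.parity + h.parity))
      (Submodule.sub_mem _ (lin_mem ((parity_cast _ _ _).trans (add_assoc _ _ _)))
        (lin_mem rfl))
  | one_tens f =>
    exact filter_vanishes_of_mem (.one_tens f) (q := f.parity)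
      (Submodule.sub_mem _ (lin_mem ((parity_cast _ _ _).trans (zero_add _))) (lin_mem rfl))
  | tens_one f =>
    exact filter_vanishes_of_mem (.tens_one f) (q := f.parity)
      (Submodule.sub_mem _ (lin_mem ((parity_cast _ _ _).trans (add_zero _))) (lin_mem rfl))
  | rel h =>
    obtain ⟨p, h₁, h₂⟩ := h.homogeneous
    exact filter_vanishes_of_mem (.rel h) (Submodule.sub_mem _ h₁ h₂)

end Homogeneous

/-! ## Bilinear vertical and horizontal composition of linear combinations -/

section Bilinear

variable {aff : Bool}

/-- The bilinear extension of an operation on diagrams. -/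
def bilin (k : Type u) [CommRing k] {X Y X' Y' X'' Y'' : List Strand}
    (F : Diagram aff X Y → Diagram aff X' Y' → Diagram aff X'' Y'') :
    LinDiagram k aff X Y →ₗ[k] LinDiagram k aff X' Y' →ₗ[k] LinDiagram k aff X'' Y'' :=
  Finsupp.linearCombination k fun f => Finsupp.lmapDomain k k (F f)

theorem bilin_lin_left {X Y X' Y' X'' Y'' : List Strand}
    (F : Diagram aff X Y → Diagram aff X' Y' → Diagram aff X'' Y'') (f : Diagram aff X Y)
    (m : LinDiagram k aff X' Y') : bilin k F (lin k f) m = m.mapDomain fun g => F f g := by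
  simp [bilin, Finsupp.linearCombination_single, Finsupp.lmapDomain_apply]

theorem bilin_lin {X Y X' Y' X'' Y'' : List Strand}
    (F : Diagram aff X Y → Diagram aff X' Y' → Diagram aff X'' Y'') (f : Diagram aff X Y)
    (g : Diagram aff X' Y') : bilin k F (lin k f) (lin k g) = lin k (F f g) := by
  rw [bilin_lin_left, Finsupp.mapDomain_single]

theorem lin_induction {X Y : List Strand} {P : LinDiagram k aff X Y → Prop}
    (h0 : P 0) (hadd : ∀ l m, P l → P m → P (l + m))
    (hlin : ∀ (c : k) f, P (c • lin k f)) (l : LinDiagram k aff X Y) : P l := by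
  induction l using Finsupp.induction_linear with
  | zero => exact h0
  | add l m hl hm => exact hadd l m hl hm
  | single f c => simpa using hlin c f

theorem bilin_lin_right {X Y X' Y' X'' Y'' : List Strand}
    (F : Diagram aff X Y → Diagram aff X' Y' → Diagram aff X'' Y'') (l : LinDiagram k aff X Y)
    (g : Diagram aff X' Y') : bilin k F l (lin k g) = l.mapDomain fun f => F f g := by
  induction l using lin_induction with
  | h0 => simp
  | hadd l m hl hm => rw [map_add, LinearMap.add_apply, hl, hm, Finsupp.mapDomain_add]
  | hlin c f =>
    rw [map_smul, LinearMap.smul_apply, bilin_lin, Finsupp.mapDomain_smul,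
      Finsupp.mapDomain_single]

theorem bilin_vanishes_left {z : k} {X Y X' Y' X'' Y'' : List Strand}
    {F : Diagram aff X Y → Diagram aff X' Y' → Diagram aff X'' Y''}
    (hF : ∀ (g : Diagram aff X' Y') {l : LinDiagram k aff X Y}, Vanishes z aff l →
      Vanishes z aff (l.mapDomain fun f => F f g))
    {l : LinDiagram k aff X Y} (hl : Vanishes z aff l) (m : LinDiagram k aff X' Y') :
    Vanishes z aff (bilin k F l m) := by
  induction m using lin_induction with
  | h0 => rw [map_zero]; exact .zero
  | hadd m n hm hn => rw [map_add]; exact .add hm hn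
  | hlin c g => rw [map_smul, bilin_lin_right]; exact .smul c (hF g hl)

theorem bilin_vanishes_right {z : k} {X Y X' Y' X'' Y'' : List Strand}
    {F : Diagram aff X Y → Diagram aff X' Y' → Diagram aff X'' Y''}
    (hF : ∀ (f : Diagram aff X Y) {m : LinDiagram k aff X' Y'}, Vanishes z aff m →
      Vanishes z aff (m.mapDomain fun g => F f g))
    (l : LinDiagram k aff X Y) {m : LinDiagram k aff X' Y'} (hm : Vanishes z aff m) :
    Vanishes z aff (bilin k F l m) := by
  induction l using lin_induction with
  | h0 => rw [map_zero]; exact .zero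
  | hadd l n hl hn => rw [map_add, LinearMap.add_apply]; exact .add hl hn
  | hlin c f =>
    rw [map_smul, LinearMap.smul_apply, bilin_lin_left]; exact .smul c (hF f hm)

/-- The bilinear operation on morphism spaces induced by an operation on diagrams. -/
def quotBilin (z : k) {X Y X' Y' X'' Y'' : List Strand}
    (F : Diagram aff X Y → Diagram aff X' Y' → Diagram aff X'' Y'')
    (h₁ : ∀ (g : Diagram aff X' Y') {l : LinDiagram k aff X Y}, Vanishes z aff l →
      Vanishes z aff (l.mapDomain fun f => F f g))
    (h₂ : ∀ (f : Diagram aff X Y) {m : LinDiagram k aff X' Y'}, Vanishes z aff m →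
      Vanishes z aff (m.mapDomain fun g => F f g)) :
    (LinDiagram k aff X Y ⧸ vanishing z aff X Y) →ₗ[k]
      (LinDiagram k aff X' Y' ⧸ vanishing z aff X' Y') →ₗ[k]
        (LinDiagram k aff X'' Y'' ⧸ vanishing z aff X'' Y'') :=
  ((bilin k F).compr₂ (vanishing z aff X'' Y'').mkQ).liftQ₂ _ _
    (fun _ hl => LinearMap.mem_ker.2 (LinearMap.ext fun m =>
      (Submodule.Quotient.mk_eq_zero _).2 (bilin_vanishes_left h₁ hl m)))
    (fun _ hm => LinearMap.mem_ker.2 (LinearMap.ext fun l =>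
      (Submodule.Quotient.mk_eq_zero _).2 (bilin_vanishes_right h₂ l hm)))

end Bilinear

end Relations

/-! # The quantum isomeric supercategory and its affine version -/

/-- The strict monoidal supercategory presented by the generators `Gen aff` and the relations
`DefRel z aff`. Its objects are the words in `↑` and `↓`. -/
def Isomeric {k : Type u} [CommRing k] (_z : k) (_aff : Bool) : Type := List Strand

/-- The quantum isomeric supercategory `𝒬(z)`. -/
abbrev QuantumIsomeric {k : Type u} [CommRing k] (z : k) : Type := Isomeric z false

/-- The quantum affine isomeric supercategory `𝒜𝒬(z)`. -/
abbrev QuantumAffineIsomeric {k : Type u} [CommRing k] (z : k) : Type := Isomeric z true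

namespace Isomeric

open Diagram

variable {k : Type u} [CommRing k] {z : k} {aff : Bool}

/-- The tensor product of objects is concatenation of words. -/
instance : Monoid (Isomeric z aff) where
  mul X Y := List.append X Y
  one := ([] : List Strand)
  mul_assoc := List.append_assoc
  one_mul := List.nil_append
  mul_one := List.append_nil

/-- A word as an object. -/
def ob (z : k) (aff : Bool) (X : List Strand) : Isomeric z aff := X

/-- The morphism spaces. -/
abbrev HomSpace (z : k) (aff : Bool) (X Y : List Strand) : Type u :=
  LinDiagram k aff X Y ⧸ vanishing z aff X Y

def compHom (z : k) (aff : Bool) (X Y Z : List Strand) :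
    HomSpace z aff X Y →ₗ[k] HomSpace z aff Y Z →ₗ[k] HomSpace z aff X Z :=
  quotBilin z (fun f g => comp f g) (fun g _ h => .comp_right g h) (fun f _ h => .comp_left f h)

def tensHom (z : k) (aff : Bool) (X Y X' Y' : List Strand) :
    HomSpace z aff X Y →ₗ[k] HomSpace z aff X' Y' →ₗ[k] HomSpace z aff (X ++ X') (Y ++ Y') :=
  quotBilin z (fun f g => tens f g) (fun g _ h => .tens_right g h) (fun f _ h => .tens_left f h)

/-- The class of a diagram in the morphism space. -/
def cls (z : k) {X Y : List Strand} (f : Diagram aff X Y) : HomSpace z aff X Y :=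
  Submodule.Quotient.mk (lin k f)

theorem compHom_cls {X Y Z : List Strand} (f : Diagram aff X Y) (g : Diagram aff Y Z) :
    compHom z aff X Y Z (cls z f) (cls z g) = cls z (comp f g) :=
  congrArg Submodule.Quotient.mk (bilin_lin (k := k) (fun f g => comp f g) f g)

theorem tensHom_cls {X Y X' Y' : List Strand} (f : Diagram aff X Y) (g : Diagram aff X' Y') :
    tensHom z aff X Y X' Y' (cls z f) (cls z g) = cls z (tens f g) :=
  congrArg Submodule.Quotient.mk (bilin_lin (k := k) (fun f g => tens f g) f g)

theorem cls_eq {X Y : List Strand} {f g : Diagram aff X Y}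
    (h : Vanishes z aff (lin k f - lin k g)) : cls z f = cls z g :=
  (Submodule.Quotient.eq _).2 h

theorem hom_induction {X Y : List Strand} {P : HomSpace z aff X Y → Prop} (h0 : P 0)
    (hadd : ∀ a b, P a → P b → P (a + b)) (hcls : ∀ (c : k) f, P (c • cls z f))
    (a : HomSpace z aff X Y) : P a := by
  induction a using Submodule.Quotient.induction_on with
  | H l =>
    induction l using lin_induction with
    | h0 => exact h0
    | hadd l m hl hm => exact hadd _ _ hl hm
    | hlin c f => exact hcls c f

theorem compHom_assoc {X Y Z W : List Strand} (a : HomSpace z aff X Y) (b : HomSpace z aff Y Z)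
    (c : HomSpace z aff Z W) :
    compHom z aff X Z W (compHom z aff X Y Z a b) c =
      compHom z aff X Y W a (compHom z aff Y Z W b c) := by
  induction a using hom_induction with
  | h0 => simp only [map_zero, LinearMap.zero_apply]
  | hadd a b ha hb => simp only [map_add, LinearMap.add_apply, ha, hb]
  | hcls r f =>
    simp only [map_smul, LinearMap.smul_apply]
    congr 1
    induction b using hom_induction with
    | h0 => simp only [map_zero, LinearMap.zero_apply]
    | hadd a b ha hb => simp only [map_add, LinearMap.add_apply, ha, hb]
    | hcls r g =>
      simp only [map_smul, LinearMap.smul_apply]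
      congr 1
      induction c using hom_induction with
      | h0 => simp only [map_zero]
      | hadd a b ha hb => simp only [map_add, ha, hb]
      | hcls r h =>
        simp only [map_smul]
        congr 1
        simp only [compHom_cls]
        exact cls_eq (.comp_assoc f g h)

theorem id_compHom {X Y : List Strand} (a : HomSpace z aff X Y) :
    compHom z aff X X Y (cls z (Diagram.id X)) a = a := by
  induction a using hom_induction with
  | h0 => simp only [map_zero]
  | hadd a b ha hb => simp only [map_add, ha, hb]
  | hcls r f =>
    simp only [map_smul, compHom_cls]
    rw [cls_eq (.id_comp f)]

theorem compHom_id {X Y : List Strand} (a : HomSpace z aff X Y) :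
    compHom z aff X Y Y a (cls z (Diagram.id Y)) = a := by
  induction a using hom_induction with
  | h0 => simp only [map_zero, LinearMap.zero_apply]
  | hadd a b ha hb => simp only [map_add, LinearMap.add_apply, ha, hb]
  | hcls r f =>
    simp only [map_smul, LinearMap.smul_apply, compHom_cls]
    rw [cls_eq (.comp_id f)]

instance : Category.{u} (Isomeric z aff) where
  Hom X Y := HomSpace z aff X Y
  id X := cls z (Diagram.id X)
  comp {X Y Z} f g := compHom z aff X Y Z f g
  id_comp := id_compHom
  comp_id := compHom_id
  assoc := compHom_assoc

instance : Preadditive (Isomeric z aff) where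
  homGroup X Y := inferInstanceAs (AddCommGroup (HomSpace z aff X Y))
  add_comp X Y Z f f' g := LinearMap.map_add₂ (compHom z aff X Y Z) f f' g
  comp_add X Y Z f g g' := LinearMap.map_add (compHom z aff X Y Z f) g g'

instance : Linear k (Isomeric z aff) where
  homModule X Y := inferInstanceAs (Module k (HomSpace z aff X Y))
  smul_comp X Y Z c f g := LinearMap.map_smul₂ (compHom z aff X Y Z) c f g
  comp_smul X Y Z f c g := LinearMap.map_smul (compHom z aff X Y Z f) c g

/-- The span of the classes of the diagrams of parity `p`. -/
def homPart (z : k) (aff : Bool) (p : ZMod 2) (X Y : List Strand) :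
    Submodule k (HomSpace z aff X Y) :=
  (linPart k aff p X Y).map (vanishing z aff X Y).mkQ

theorem cls_mem {X Y : List Strand} {p : ZMod 2} {f : Diagram aff X Y} (h : f.parity = p) :
    cls z f ∈ homPart z aff p X Y :=
  Submodule.mem_map_of_mem (lin_mem h)

theorem part_induction {X Y : List Strand} {p : ZMod 2} {P : HomSpace z aff X Y → Prop}
    (h0 : P 0) (hadd : ∀ a b, P a → P b → P (a + b))
    (hcls : ∀ (c : k) f, f.parity = p → P (c • cls z f)) {a : HomSpace z aff X Y}
    (ha : a ∈ homPart z aff p X Y) : P a := by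
  obtain ⟨l, hl, rfl⟩ := ha
  have hl' : l ∈ Submodule.span k ((fun f => lin k f) ''
      {f : Diagram aff X Y | f.parity = p}) := by
    rw [← Finsupp.supported_eq_span_single]; exact hl
  have key : ∀ c : k, P (c • (vanishing z aff X Y).mkQ l) := by
    clear hl
    induction hl' using Submodule.span_induction with
    | mem l h =>
      obtain ⟨f, hf, rfl⟩ := h
      exact fun c => hcls c f hf
    | zero => intro c; rw [map_zero, smul_zero]; exact h0
    | add l m _ _ hl hm => intro c; rw [map_add, smul_add]; exact hadd _ _ (hl c) (hm c)
    | smul r l _ hl => intro c; rw [map_smul, smul_smul]; exact hl _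
  simpa using key 1

theorem homPart_isCompl (X Y : List Strand) :
    IsCompl (homPart z aff 0 X Y) (homPart z aff 1 X Y) := by
  refine ⟨Submodule.disjoint_def.2 ?_, codisjoint_iff.2 (eq_top_iff.2 fun a _ => ?_)⟩
  · rintro _ ⟨l, hl, rfl⟩ ⟨m, hm, e⟩
    have h : Vanishes z aff (l - m) := (Submodule.Quotient.eq _).1 e.symm
    have h' := h.filter 0
    rw [Finsupp.filter_sub, filter_of_mem hl, filter_of_mem hm, if_pos rfl,
      if_neg (by decide), sub_zero] at h'
    exact (Submodule.Quotient.mk_eq_zero _).2 h'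
  · induction a using hom_induction with
    | h0 => exact Submodule.zero_mem _
    | hadd a b ha hb => exact Submodule.add_mem _ (ha trivial) (hb trivial)
    | hcls c f =>
      have h : f.parity = 0 ∨ f.parity = 1 := by
        generalize f.parity = p
        revert p; decide
      rcases h with h | h
      · exact Submodule.mem_sup_left (Submodule.smul_mem _ _ (cls_mem h))
      · exact Submodule.mem_sup_right (Submodule.smul_mem _ _ (cls_mem h))

theorem bilin_mem {X Y X' Y' X'' Y'' : List Strand} {p q : ZMod 2}
    {B : HomSpace z aff X Y →ₗ[k] HomSpace z aff X' Y' →ₗ[k] HomSpace z aff X'' Y''}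
    (hB : ∀ f g, f.parity = p → g.parity = q → B (cls z f) (cls z g) ∈ homPart z aff (p + q) X'' Y'')
    {a : HomSpace z aff X Y} {b : HomSpace z aff X' Y'} (ha : a ∈ homPart z aff p X Y)
    (hb : b ∈ homPart z aff q X' Y') : B a b ∈ homPart z aff (p + q) X'' Y'' := by
  refine part_induction (P := fun a => B a b ∈ homPart z aff (p + q) X'' Y'') ?_ ?_ ?_ ha
  · simp only [map_zero, LinearMap.zero_apply]; exact Submodule.zero_mem _
  · intro a a' h h'
    simp only [map_add, LinearMap.add_apply]; exact Submodule.add_mem _ h h'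
  · intro c f hf
    simp only [map_smul, LinearMap.smul_apply]
    refine Submodule.smul_mem _ _ ?_
    refine part_induction (P := fun b => B (cls z f) b ∈ homPart z aff (p + q) X'' Y'') ?_ ?_ ?_ hb
    · simp only [map_zero]; exact Submodule.zero_mem _
    · intro a a' h h'
      simp only [map_add]; exact Submodule.add_mem _ h h'
    · intro c g hg
      simp only [map_smul]
      exact Submodule.smul_mem _ _ (hB f g hf hg)

theorem compHom_mem {X Y Z : List Strand} {p q : ZMod 2} {a : HomSpace z aff X Y}
    {b : HomSpace z aff Y Z} (ha : a ∈ homPart z aff p X Y) (hb : b ∈ homPart z aff q Y Z) :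
    compHom z aff X Y Z a b ∈ homPart z aff (p + q) X Z :=
  bilin_mem (fun f g hf hg => by
    rw [compHom_cls]
    exact cls_mem (congrArg₂ _ hf hg)) ha hb

theorem tensHom_mem {X Y X' Y' : List Strand} {p q : ZMod 2} {a : HomSpace z aff X Y}
    {b : HomSpace z aff X' Y'} (ha : a ∈ homPart z aff p X Y) (hb : b ∈ homPart z aff q X' Y') :
    tensHom z aff X Y X' Y' a b ∈ homPart z aff (p + q) (X ++ X') (Y ++ Y') :=
  bilin_mem (fun f g hf hg => by
    rw [tensHom_cls]
    exact cls_mem (congrArg₂ _ hf hg)) ha hb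

instance : Supercategory k (Isomeric z aff) where
  part p X Y := homPart z aff p X Y
  isCompl := homPart_isCompl
  id_mem _ := cls_mem rfl
  comp_mem hf hg := compHom_mem hf hg

theorem tensHom_interchange {p q : ZMod 2} {X Y Z X' Y' Z' : List Strand}
    {a : HomSpace z aff X Y} (a' : HomSpace z aff Y Z) (b' : HomSpace z aff X' Y')
    {b : HomSpace z aff Y' Z'} (ha : a ∈ homPart z aff p X Y) (hb : b ∈ homPart z aff q Y' Z') :
    compHom z aff _ _ _ (tensHom z aff _ _ _ _ a b') (tensHom z aff _ _ _ _ a' b) =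
      koszul k p q • tensHom z aff _ _ _ _ (compHom z aff _ _ _ a a')
        (compHom z aff _ _ _ b' b) := by
  refine part_induction (P := fun a =>
    compHom z aff _ _ _ (tensHom z aff _ _ _ _ a b') (tensHom z aff _ _ _ _ a' b) =
      koszul k p q • tensHom z aff _ _ _ _ (compHom z aff _ _ _ a a')
        (compHom z aff _ _ _ b' b)) ?_ ?_ ?_ ha
  · simp only [map_zero, LinearMap.zero_apply, smul_zero]
  · intro a₁ a₂ h₁ h₂
    simp only [map_add, LinearMap.add_apply, smul_add, h₁, h₂]
  intro c f hf
  simp only [map_smul, LinearMap.smul_apply]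
  rw [smul_comm]
  congr 1
  refine part_induction (P := fun b =>
    compHom z aff _ _ _ (tensHom z aff _ _ _ _ (cls z f) b') (tensHom z aff _ _ _ _ a' b) =
      koszul k p q • tensHom z aff _ _ _ _ (compHom z aff _ _ _ (cls z f) a')
        (compHom z aff _ _ _ b' b)) ?_ ?_ ?_ hb
  · simp only [map_zero, smul_zero]
  · intro a₁ a₂ h₁ h₂
    simp only [map_add, smul_add, h₁, h₂]
  intro c g hg
  simp only [map_smul]
  rw [smul_comm]
  congr 1
  induction a' using hom_induction with
  | h0 => simp only [map_zero, LinearMap.zero_apply, smul_zero]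
  | hadd a b ha hb => simp only [map_add, LinearMap.add_apply, smul_add, ha, hb]
  | hcls c f' =>
    simp only [map_smul, LinearMap.smul_apply]
    rw [smul_comm]
    congr 1
    induction b' using hom_induction with
    | h0 => simp only [map_zero, LinearMap.zero_apply, smul_zero]
    | hadd a b ha hb => simp only [map_add, LinearMap.add_apply, smul_add, ha, hb]
    | hcls c g' =>
      simp only [map_smul, LinearMap.smul_apply]
      rw [smul_comm]
      congr 1
      simp only [compHom_cls, tensHom_cls]
      have h := Vanishes.interchange (k := k) (z := z) f f' g' g
      rw [hf, hg] at h
      exact (Submodule.Quotient.eq (vanishing z aff (X ++ X') (Z ++ Z'))).2 h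

/-- Transport of a morphism along equalities of its source and target. -/
def castHom {X X' Y Y' : List Strand} (hX : X = X') (hY : Y = Y') :
    HomSpace z aff X Y →ₗ[k] HomSpace z aff X' Y' :=
  hX ▸ hY ▸ LinearMap.id

theorem castHom_cls {X X' Y Y' : List Strand} (hX : X = X') (hY : Y = Y')
    (f : Diagram aff X Y) : castHom hX hY (cls z f) = cls z (f.cast hX hY) := by
  subst hX; subst hY; rfl

theorem eq_of_castHom {X X' Y Y' : Isomeric z aff} (hX : X = X') (hY : Y = Y')
    {a : X ⟶ Y} {b : X' ⟶ Y'} (h : castHom hX hY a = b) :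
    a = eqToHom hX ≫ b ≫ eqToHom hY.symm := by
  subst hX; subst hY
  rw [← h]
  simp only [eqToHom_refl, Category.comp_id, Category.id_comp]
  rfl

theorem tensHom_assoc {X Y X' Y' X'' Y'' : List Strand} (a : HomSpace z aff X Y)
    (b : HomSpace z aff X' Y') (c : HomSpace z aff X'' Y'') :
    castHom (List.append_assoc X X' X'') (List.append_assoc Y Y' Y'')
        (tensHom z aff _ _ _ _ (tensHom z aff _ _ _ _ a b) c) =
      tensHom z aff _ _ _ _ a (tensHom z aff _ _ _ _ b c) := by
  induction a using hom_induction with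
  | h0 => simp only [map_zero, LinearMap.zero_apply]
  | hadd a b ha hb => simp only [map_add, LinearMap.add_apply, ha, hb]
  | hcls r f =>
    simp only [map_smul, LinearMap.smul_apply]
    congr 1
    induction b using hom_induction with
    | h0 => simp only [map_zero, LinearMap.zero_apply]
    | hadd a b ha hb => simp only [map_add, LinearMap.add_apply, ha, hb]
    | hcls r g =>
      simp only [map_smul, LinearMap.smul_apply]
      congr 1
      induction c using hom_induction with
      | h0 => simp only [map_zero]
      | hadd a b ha hb => simp only [map_add, ha, hb]
      | hcls r h =>
        simp only [map_smul]
        congr 1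
        simp only [tensHom_cls, castHom_cls]
        exact cls_eq (.tens_assoc f g h)

theorem one_tensHom {X Y : List Strand} (a : HomSpace z aff X Y) :
    castHom (List.nil_append X) (List.nil_append Y)
      (tensHom z aff _ _ _ _ (cls z (Diagram.id [])) a) = a := by
  induction a using hom_induction with
  | h0 => simp only [map_zero]
  | hadd a b ha hb => simp only [map_add, ha, hb]
  | hcls r f =>
    simp only [map_smul, tensHom_cls, castHom_cls]
    rw [cls_eq (.one_tens f)]

theorem tensHom_one {X Y : List Strand} (a : HomSpace z aff X Y) :
    castHom (List.append_nil X) (List.append_nil Y)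
      (tensHom z aff _ _ _ _ a (cls z (Diagram.id []))) = a := by
  induction a using hom_induction with
  | h0 => simp only [map_zero, LinearMap.zero_apply]
  | hadd a b ha hb => simp only [map_add, LinearMap.add_apply, ha, hb]
  | hcls r f =>
    simp only [map_smul, LinearMap.smul_apply, tensHom_cls, castHom_cls]
    rw [cls_eq (.tens_one f)]

instance : StrictMonoidalSupercategory k (Isomeric z aff) where
  tensor {X Y X' Y'} f g := tensHom z aff X Y X' Y' f g
  add_tensor {X Y X' Y'} f₁ f₂ g := LinearMap.map_add₂ (tensHom z aff X Y X' Y') f₁ f₂ g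
  tensor_add {X Y X' Y'} f g₁ g₂ := LinearMap.map_add (tensHom z aff X Y X' Y' f) g₁ g₂
  smul_tensor {X Y X' Y'} r f g := LinearMap.map_smul₂ (tensHom z aff X Y X' Y') r f g
  tensor_smul {X Y X' Y'} r f g := LinearMap.map_smul (tensHom z aff X Y X' Y' f) r g
  tensor_mem hf hg := tensHom_mem hf hg
  tensor_id X Y := (tensHom_cls _ _).trans (cls_eq (.tens_id X Y))
  interchange f' g' _ hf hg := tensHom_interchange f' g' hf hg
  tensor_assoc f g h := eq_of_castHom _ _ (tensHom_assoc f g h)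
  one_tensor f := eq_of_castHom _ _ (one_tensHom f)
  tensor_one f := eq_of_castHom _ _ (tensHom_one f)

/-- The morphism represented by a diagram. -/
def mor (z : k) {X Y : List Strand} (f : Diagram aff X Y) : ob z aff X ⟶ ob z aff Y := cls z f

/-- The positive crossing `↑ ⊗ ↓ → ↓ ⊗ ↑` (the downward strand is the over-strand): the negative
one plus `z` times the right cap followed by the right cup. -/
def posRight (z : k) (aff : Bool) : ob z aff [up, dn] ⟶ ob z aff [dn, up] :=
  mor z negRight + z • (mor z capRight ≫ mor z cupRight)

/-- The crossing `↑ ⊗ x → x ⊗ ↑` in which the strand `x` passes over the strand `↑`. -/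
def crossOne (z : k) : ∀ x : Strand,
    ob z false [up] * ob z false [x] ⟶ ob z false [x] * ob z false [up]
  | up => mor z negUp
  | dn => posRight z false

/-- The crossing `x ⊗ ↑ → ↑ ⊗ x` in which the strand `x` passes over the strand `↑`. -/
def crossOneBack (z : k) : ∀ x : Strand,
    ob z false [x] * ob z false [up] ⟶ ob z false [up] * ob z false [x]
  | up => mor z posUp
  | dn => mor z negLeft

open StrictMonoidalSupercategory in
/-- The morphism `↑ ⊗ X → X ⊗ ↑` in which the strand `↑` passes to the right under all the strands
of `X`. -/
def cross (z : k) : ∀ X : List Strand,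
    ob z false [up] * ob z false X ⟶ ob z false X * ob z false [up]
  | [] => 𝟙 (ob z false [up])
  | x :: X =>
    (tensor (k := k) (crossOne z x) (𝟙 (ob z false X)) :
      ob z false (up :: x :: X) ⟶ ob z false (x :: up :: X)) ≫
    (tensor (k := k) (𝟙 (ob z false [x])) (cross z X) :
      ob z false (x :: up :: X) ⟶ ob z false (x :: (X ++ [up])))

open StrictMonoidalSupercategory in
/-- The morphism `X ⊗ ↑ → ↑ ⊗ X` in which the strand `↑` passes to the left under all the strands
of `X`. -/
def crossBack (z : k) : ∀ X : List Strand,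
    ob z false X * ob z false [up] ⟶ ob z false [up] * ob z false X
  | [] => 𝟙 (ob z false [up])
  | x :: X =>
    (tensor (k := k) (𝟙 (ob z false [x])) (crossBack z X) :
      ob z false (x :: (X ++ [up])) ⟶ ob z false (x :: up :: X)) ≫
    (tensor (k := k) (crossOneBack z x) (𝟙 (ob z false X)) :
      ob z false (x :: up :: X) ⟶ ob z false (up :: x :: X))

/-- The endomorphism of `↑ ⊗ X` obtained by passing the strand `↑` under `X`, applying the closed
Clifford token to it on the right of `X`, and passing it back under `X`. -/
def collapseToken (z : k) (X : List Strand) :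
    ob z false [up] * ob z false X ⟶ ob z false [up] * ob z false X :=
  cross z X ≫
    StrictMonoidalSupercategory.tensor (k := k) (𝟙 (ob z false X)) (mor z token) ≫
      crossBack z X

end Isomeric

/-! # The collapsing superfunctor -/

section Collapse

open Diagram Isomeric

variable {k : Type u} [CommRing k] {z : k}

/-- Strict monoidal superfunctors from the quantum affine isomeric supercategory to the
endosuperfunctors of the quantum isomeric supercategory. -/
abbrev AffineAction (z : k) : Type u :=
  MonoidalSuperfunctor k (QuantumAffineIsomeric z) (SEnd k (QuantumIsomeric z))

/-- On objects, `C X = X ⊗ -`. -/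
def ActsOnObjects (C : AffineAction z) : Prop :=
  ∀ X : List Strand, C.obj (ob z true X) = tensorLeftFunctor k (ob z false X)

/-- For `C` with `C X = X ⊗ -` on objects: the collapseImage of `f : X → Y` as a supernatural
transformation `X ⊗ - ⇒ Y ⊗ -`. -/
def collapseImage {C : AffineAction z} (hC : ActsOnObjects C) {X Y : List Strand}
    (f : ob z true X ⟶ ob z true Y) :
    tensorLeftFunctor k (ob z false X) ⟶ tensorLeftFunctor k (ob z false Y) :=
  eqToHom (hC X).symm ≫ C.map f ≫ eqToHom (hC Y)

/-- The conditions that define the collapsing superfunctor. -/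
structure IsCollapsing (C : AffineAction z) : Prop where
  onObjects : ActsOnObjects C
  posUp : collapseImage onObjects (mor z posUp) = tensorLeftMap k (mor z posUp)
  negUp : collapseImage onObjects (mor z negUp) = tensorLeftMap k (mor z negUp)
  posRight : collapseImage onObjects (posRight z true) = tensorLeftMap k (posRight z false)
  capLeft : collapseImage onObjects (mor z capLeft) = tensorLeftMap k (mor z capLeft)
  cupLeft : collapseImage onObjects (mor z cupLeft) = tensorLeftMap k (mor z cupLeft)
  token : collapseImage onObjects (mor z token) = tensorLeftMap k (mor z token)
  openToken : ∀ X : List Strand,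
    SEnd.app (collapseImage onObjects (mor z openToken)) (ob z false X) = collapseToken z X

end Collapse

end

noncomputable section

universe u v w

open Strand

/-! # Whiskering in the isomeric supercategories -/

namespace Isomeric

open Diagram

variable {k : Type u} [CommRing k] {z : k} {aff : Bool}

/-! By the universal property of a presentation (`Interpretation.Respects.functor`), a monoidal
superfunctor out of $\mathcal{AQ}(z)$ amounts to images of the objects and generators, of the right
parity, for which the defining relations hold. The relations of $\mathcal Q(z)$ are inherited, since
a diagram $f$ without open tokens is sent to $f\otimes-$ (`collapseApp_incl`). It remains to treat
the family $o_X=t_X(1_X\otimes\tau)s_X$.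

The key fact is that $t_X$ is natural in $X$: every morphism of $\mathcal Q(z)$ can be pulled over
an upward strand (`passesOver`). For $P$ this is the braid relation, and for $\tau$ it is the
relation $P(\tau\otimes1)=(1\otimes\tau)P$. For the cap and the cup it follows from the zigzag
relations, because the crossing $L^-$ is a rotation of $N$, so that $P$ and $N$ meet and cancel. The
morphism $L^+$ is built from these, and $N$ and $R^-$ follow as inverses.

Moreover $s_X$ is inverse to $t_X$. The point to check is that $R^+$ is inverse to $L^-$; rotating
the skein relation gives $L^+=L^-+z\,\eta\varepsilon$, and the vanishing bubble removes the
quadratic term. Thus $o_X$ is a conjugate of $1_X\otimes\tau$ by natural even isomorphisms: it is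
odd, supernatural (`otok_naturality`) and squares to $-1$ (`otok_sq`). The crossing relation holds
because $o_{\uparrow\otimes X}=P(1_\uparrow\otimes o_X)N$.

For $\varepsilon'(o\otimes1_\downarrow)\eta=0$, the crossings of the additional downward strand are
absorbed into the cup and the cap, which leaves $\varepsilon(1_\downarrow\otimes o_X)\eta'$ with
strands $X$ on the right. Since a right cup can be pulled under a strand (`rcup_underDown`), this
circle moves to the right of $X$ one strand at a time. It ends as a circle carrying one closed
token, which is zero by a relation of $\mathcal Q(z)$ (`circle_otok`).

Uniqueness: all generators except $R^-$ have prescribed images. As $R^-$ is the inverse of $L^+$,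
which is composed of $P$, $\varepsilon$ and $\eta$, its image is forced to be $R^-\otimes-$
(`agrees_negRight`). -/

/-- The tensor product of morphisms between words. -/
def tm {X Y X' Y' : List Strand} (f : ob z aff X ⟶ ob z aff Y) (g : ob z aff X' ⟶ ob z aff Y') :
    ob z aff (X ++ X') ⟶ ob z aff (Y ++ Y') :=
  tensHom z aff X Y X' Y' f g

/-- Homogeneous morphisms of parity `p`. -/
def HasParity (p : ZMod 2) {X Y : List Strand} (f : ob z aff X ⟶ ob z aff Y) : Prop :=
  f ∈ homPart z aff p X Y

/-- Even morphisms. -/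
abbrev IsEven {X Y : List Strand} (f : ob z aff X ⟶ ob z aff Y) : Prop := HasParity 0 f

theorem isEven_id (X : List Strand) : IsEven (𝟙 (ob z aff X)) := cls_mem rfl

theorem isEven_mor {X Y : List Strand} {f : Diagram aff X Y} (h : f.parity = 0) :
    IsEven (mor z f) := cls_mem h

theorem IsEven.comp {X Y Z : List Strand} {f : ob z aff X ⟶ ob z aff Y}
    {g : ob z aff Y ⟶ ob z aff Z} (hf : IsEven f) (hg : IsEven g) : IsEven (f ≫ g) :=
  compHom_mem (p := 0) (q := 0) hf hg

theorem isEven_tm {X Y X' Y' : List Strand} {f : ob z aff X ⟶ ob z aff Y}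
    {g : ob z aff X' ⟶ ob z aff Y'} (hf : IsEven f) (hg : IsEven g) : IsEven (tm f g) :=
  tensHom_mem (p := 0) (q := 0) hf hg

theorem IsEven.add {X Y : List Strand} {f g : ob z aff X ⟶ ob z aff Y} (hf : IsEven f)
    (hg : IsEven g) : IsEven (f + g) := Submodule.add_mem _ hf hg

theorem IsEven.smul {X Y : List Strand} (c : k) {f : ob z aff X ⟶ ob z aff Y} (hf : IsEven f) :
    IsEven (c • f) := Submodule.smul_mem (homPart z aff 0 X Y) c hf

theorem tm_interchange {p q : ZMod 2} {X Y Z X' Y' Z' : List Strand}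
    {f : ob z aff X ⟶ ob z aff Y} (f' : ob z aff Y ⟶ ob z aff Z)
    (g' : ob z aff X' ⟶ ob z aff Y') {g : ob z aff Y' ⟶ ob z aff Z'}
    (hf : HasParity p f) (hg : HasParity q g) :
    tm f g' ≫ tm f' g = koszul k p q • tm (f ≫ f') (g' ≫ g) :=
  tensHom_interchange f' g' hf hg

theorem exists_homPart_decomp {X Y : List Strand} (f : ob z aff X ⟶ ob z aff Y) :
    ∃ f₀ f₁ : ob z aff X ⟶ ob z aff Y, HasParity 0 f₀ ∧ HasParity 1 f₁ ∧ f₀ + f₁ = f := by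
  obtain ⟨f₀, h₀, f₁, h₁, e⟩ := Supercategory.exists_decomp k f
  exact ⟨f₀, f₁, h₀, h₁, e⟩

theorem tm_add_left {X Y X' Y' : List Strand} (f f' : ob z aff X ⟶ ob z aff Y)
    (g : ob z aff X' ⟶ ob z aff Y') : tm (f + f') g = tm f g + tm f' g :=
  LinearMap.map_add₂ (tensHom z aff X Y X' Y') f f' g

theorem tm_add_right {X Y X' Y' : List Strand} (f : ob z aff X ⟶ ob z aff Y)
    (g g' : ob z aff X' ⟶ ob z aff Y') : tm f (g + g') = tm f g + tm f g' :=
  LinearMap.map_add (tensHom z aff X Y X' Y' f) g g'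

theorem tm_smul_left {X Y X' Y' : List Strand} (c : k) (f : ob z aff X ⟶ ob z aff Y)
    (g : ob z aff X' ⟶ ob z aff Y') : tm (c • f) g = c • tm f g :=
  LinearMap.map_smul₂ (tensHom z aff X Y X' Y') c f g

theorem tm_smul_right {X Y X' Y' : List Strand} (c : k) (f : ob z aff X ⟶ ob z aff Y)
    (g : ob z aff X' ⟶ ob z aff Y') : tm f (c • g) = c • tm f g :=
  LinearMap.map_smul (tensHom z aff X Y X' Y' f) c g

theorem tm_zero_left {X Y X' Y' : List Strand} (g : ob z aff X' ⟶ ob z aff Y') :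
    tm (0 : ob z aff X ⟶ ob z aff Y) g = 0 :=
  LinearMap.map_zero₂ (tensHom z aff X Y X' Y') g

theorem tm_zero_right {X Y X' Y' : List Strand} (f : ob z aff X ⟶ ob z aff Y) :
    tm f (0 : ob z aff X' ⟶ ob z aff Y') = 0 :=
  LinearMap.map_zero (tensHom z aff X Y X' Y' f)

theorem tm_id (X Y : List Strand) : tm (𝟙 (ob z aff X)) (𝟙 (ob z aff Y)) = 𝟙 (ob z aff (X ++ Y)) :=
  (tensHom_cls _ _).trans (cls_eq (.tens_id X Y))

/-- The interchange sign depends only on the parities of `f` and `g`. When `f` is even it is trivial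
on both homogeneous parts of `g`, and additivity does the rest. -/
theorem tm_comp_of_even_left {X Y Z X' Y' Z' : List Strand}
    {f : ob z aff X ⟶ ob z aff Y} (hf : IsEven f) (f' : ob z aff Y ⟶ ob z aff Z)
    (g' : ob z aff X' ⟶ ob z aff Y') (g : ob z aff Y' ⟶ ob z aff Z') :
    tm f g' ≫ tm f' g = tm (f ≫ f') (g' ≫ g) := by
  obtain ⟨g₀, g₁, h₀, h₁, rfl⟩ := exists_homPart_decomp g
  have e₀ := tm_interchange f' g' hf h₀
  have e₁ := tm_interchange f' g' hf h₁
  rw [koszul_zero_left, one_smul] at e₀ e₁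
  rw [tm_add_right, Preadditive.comp_add, e₀, e₁, Preadditive.comp_add, tm_add_right]

theorem tm_comp_of_even_right {X Y Z X' Y' Z' : List Strand}
    (f : ob z aff X ⟶ ob z aff Y) (f' : ob z aff Y ⟶ ob z aff Z)
    (g' : ob z aff X' ⟶ ob z aff Y') {g : ob z aff Y' ⟶ ob z aff Z'} (hg : IsEven g) :
    tm f g' ≫ tm f' g = tm (f ≫ f') (g' ≫ g) := by
  obtain ⟨g₀, g₁, h₀, h₁, rfl⟩ := exists_homPart_decomp f
  have e₀ := tm_interchange f' g' h₀ hg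
  have e₁ := tm_interchange f' g' h₁ hg
  rw [koszul_zero_right, one_smul] at e₀ e₁
  rw [tm_add_left, Preadditive.add_comp, e₀, e₁, Preadditive.add_comp, tm_add_left]

theorem id_tm_comp (W : List Strand) {X Y Z : List Strand} (f : ob z aff X ⟶ ob z aff Y)
    (g : ob z aff Y ⟶ ob z aff Z) :
    tm (𝟙 (ob z aff W)) (f ≫ g) = tm (𝟙 (ob z aff W)) f ≫ tm (𝟙 (ob z aff W)) g := by
  rw [tm_comp_of_even_left (isEven_id W), Category.id_comp]

theorem comp_tm_id (W : List Strand) {X Y Z : List Strand} (f : ob z aff X ⟶ ob z aff Y)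
    (g : ob z aff Y ⟶ ob z aff Z) :
    tm (f ≫ g) (𝟙 (ob z aff W)) = tm f (𝟙 (ob z aff W)) ≫ tm g (𝟙 (ob z aff W)) := by
  rw [tm_comp_of_even_right _ _ _ (isEven_id W), Category.id_comp]

/-- With the right-hand factor applied first, the two factors whose parities enter the sign are
identities. Hence this splitting of a tensor product is valid without any homogeneity. -/
theorem id_tm_comp_tm_id {X Y X' Y' : List Strand} (f : ob z aff X ⟶ ob z aff Y)
    (g : ob z aff X' ⟶ ob z aff Y') :
    tm (𝟙 _) g ≫ tm f (𝟙 _) = tm f g := by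
  rw [tm_comp_of_even_left (isEven_id X), Category.id_comp, Category.comp_id]

theorem tm_id_comp_id_tm {X Y X' Y' : List Strand} {f : ob z aff X ⟶ ob z aff Y} (hf : IsEven f)
    (g : ob z aff X' ⟶ ob z aff Y') :
    tm f (𝟙 _) ≫ tm (𝟙 _) g = tm f g := by
  rw [tm_comp_of_even_left hf, Category.id_comp, Category.comp_id]

theorem tm_id_comm {X Y X' Y' : List Strand} {f : ob z aff X ⟶ ob z aff Y} (hf : IsEven f)
    (g : ob z aff X' ⟶ ob z aff Y') :
    tm f (𝟙 _) ≫ tm (𝟙 _) g = tm (𝟙 _) g ≫ tm f (𝟙 _) := by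
  rw [tm_id_comp_id_tm hf, id_tm_comp_tm_id]

/-- Here the left factor may be odd, as is needed for sliding a token past an even morphism
(`tok_naturality`). -/
theorem tm_id_comm' {X Y X' Y' : List Strand} (f : ob z aff X ⟶ ob z aff Y)
    {g : ob z aff X' ⟶ ob z aff Y'} (hg : IsEven g) :
    tm f (𝟙 _) ≫ tm (𝟙 _) g = tm (𝟙 _) g ≫ tm f (𝟙 _) := by
  rw [tm_comp_of_even_right _ _ _ hg, id_tm_comp_tm_id, Category.id_comp, Category.comp_id]

/-- The morphism `1_x ⊗ f` for a strand `x`. -/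
def wl (x : Strand) {X Y : List Strand} (f : ob z aff X ⟶ ob z aff Y) :
    ob z aff (x :: X) ⟶ ob z aff (x :: Y) :=
  tm (𝟙 (ob z aff [x])) f

/-- The morphism `f ⊗ 1_Z` for a morphism `f` with two strands at the bottom and at the top. -/
def box {a b c d : Strand} (f : ob z aff [a, b] ⟶ ob z aff [c, d]) (Z : List Strand) :
    ob z aff (a :: b :: Z) ⟶ ob z aff (c :: d :: Z) :=
  tm f (𝟙 (ob z aff Z))

/-- The left cap on the left of `1_Z`. -/
def cap (Z : List Strand) : ob z aff (dn :: up :: Z) ⟶ ob z aff Z :=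
  tm (mor z capLeft) (𝟙 (ob z aff Z))

/-- The left cup on the left of `1_Z`. -/
def cup (Z : List Strand) : ob z aff Z ⟶ ob z aff (up :: dn :: Z) :=
  tm (mor z cupLeft) (𝟙 (ob z aff Z))

/-- The closed Clifford token on the left of `1_Z`. -/
def tok (Z : List Strand) : ob z aff (up :: Z) ⟶ ob z aff (up :: Z) :=
  tm (mor z token) (𝟙 (ob z aff Z))

/-! ### Calculus of whiskered morphisms -/

theorem tm_assoc {X Y X' Y' X'' Y'' : List Strand} (a : ob z aff X ⟶ ob z aff Y)
    (b : ob z aff X' ⟶ ob z aff Y') (c : ob z aff X'' ⟶ ob z aff Y'') :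
    castHom (List.append_assoc X X' X'') (List.append_assoc Y Y' Y'') (tm (tm a b) c) =
      tm a (tm b c) :=
  tensHom_assoc a b c

theorem wl_comp (x : Strand) {X Y Z : List Strand} (f : ob z aff X ⟶ ob z aff Y)
    (g : ob z aff Y ⟶ ob z aff Z) : wl x (f ≫ g) = wl x f ≫ wl x g :=
  id_tm_comp [x] f g

theorem wl_id (x : Strand) (X : List Strand) : wl x (𝟙 (ob z aff X)) = 𝟙 (ob z aff (x :: X)) :=
  tm_id [x] X

theorem wl_zero (x : Strand) {X Y : List Strand} :
    wl x (0 : ob z aff X ⟶ ob z aff Y) = 0 := tm_zero_right _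

theorem wl_add (x : Strand) {X Y : List Strand} (f g : ob z aff X ⟶ ob z aff Y) :
    wl x (f + g) = wl x f + wl x g := tm_add_right _ _ _

theorem wl_smul (x : Strand) {X Y : List Strand} (c : k) (f : ob z aff X ⟶ ob z aff Y) :
    wl x (c • f) = c • wl x f := tm_smul_right _ _ _

theorem IsEven.wl (x : Strand) {X Y : List Strand} {f : ob z aff X ⟶ ob z aff Y} (hf : IsEven f) :
    IsEven (wl x f) := isEven_tm (isEven_id [x]) hf

theorem IsEven.box {a b c d : Strand} {f : ob z aff [a, b] ⟶ ob z aff [c, d]} (hf : IsEven f)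
    (Z : List Strand) : IsEven (box f Z) := isEven_tm hf (isEven_id Z)

theorem box_comp {a b c d e e' : Strand} (f : ob z aff [a, b] ⟶ ob z aff [c, d])
    (g : ob z aff [c, d] ⟶ ob z aff [e, e']) (Z : List Strand) :
    box (f ≫ g) Z = box f Z ≫ box g Z := comp_tm_id Z f g

theorem box_id (a b : Strand) (Z : List Strand) :
    box (𝟙 (ob z aff [a, b])) Z = 𝟙 (ob z aff (a :: b :: Z)) := tm_id [a, b] Z

theorem box_nil {a b c d : Strand} (f : ob z aff [a, b] ⟶ ob z aff [c, d]) : box f [] = f :=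
  tensHom_one f

theorem tok_nil : tok [] = mor z (token (aff := aff)) := tensHom_one (cls z token)

/-- The words on the left are literal lists, so the two bracketings of the concatenation agree
definitionally and the transport in `tm_assoc` reduces to the identity. An explicit `castHom`
survives where the left word is a variable, as in `passesOver_mor_tm_id`. -/
theorem wl_wl {a b : Strand} {X Y : List Strand} (f : ob z aff X ⟶ ob z aff Y) :
    wl a (wl b f) = tm (𝟙 (ob z aff [a, b])) f := by
  rw [show 𝟙 (ob z aff [a, b]) = tm (𝟙 (ob z aff [a])) (𝟙 (ob z aff [b])) from (tm_id [a] [b]).symm]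
  exact (tm_assoc (𝟙 (ob z aff [a])) (𝟙 (ob z aff [b])) f).symm

theorem box_wl_wl {a b c d : Strand} {f : ob z aff [a, b] ⟶ ob z aff [c, d]} (hf : IsEven f)
    {X Y : List Strand} (g : ob z aff X ⟶ ob z aff Y) :
    box f X ≫ wl c (wl d g) = wl a (wl b g) ≫ box f Y := by
  rw [wl_wl, wl_wl]
  exact tm_id_comm hf g

theorem tm_nil_left {X Y : List Strand} (g : ob z aff X ⟶ ob z aff Y) :
    tm (𝟙 (ob z aff [])) g = g := one_tensHom g

/-- The cap is even, so it interchanges with `g` without a sign; above the cap its tensor factor is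
the empty word and disappears. -/
theorem cap_naturality {X Y : List Strand} (g : ob z aff X ⟶ ob z aff Y) :
    cap X ≫ g = wl dn (wl up g) ≫ cap Y := by
  rw [wl_wl]
  refine Eq.trans ?_ (tm_id_comm (isEven_mor (f := capLeft) rfl) g)
  exact congrArg (cap X ≫ ·) (tm_nil_left g).symm

theorem cup_naturality {X Y : List Strand} (g : ob z aff X ⟶ ob z aff Y) :
    cup X ≫ wl up (wl dn g) = g ≫ cup Y := by
  rw [wl_wl]
  refine Eq.trans (tm_id_comm (isEven_mor (f := cupLeft) rfl) g) ?_
  exact congrArg (· ≫ cup Y) (tm_nil_left g)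

theorem tok_naturality {X Y : List Strand} {g : ob z aff X ⟶ ob z aff Y} (hg : IsEven g) :
    tok X ≫ wl up g = wl up g ≫ tok Y :=
  tm_id_comm' _ hg

/-! # The defining relations with further strands on the right -/

theorem mor_comp {X Y Z : List Strand} (f : Diagram aff X Y) (g : Diagram aff Y Z) :
    mor z (Diagram.comp f g) = mor z f ≫ mor z g :=
  (compHom_cls f g).symm

theorem mor_tens {X Y X' Y' : List Strand} (f : Diagram aff X Y) (g : Diagram aff X' Y') :
    mor z (Diagram.tens f g) = tm (mor z f) (mor z g) :=
  (tensHom_cls f g).symm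

theorem mor_id (X : List Strand) : mor z (Diagram.id X : Diagram aff X X) = 𝟙 (ob z aff X) := rfl

theorem wl_tm_id (x : Strand) {X Y : List Strand} (f : ob z aff X ⟶ ob z aff Y)
    (Z : List Strand) : tm (wl x f) (𝟙 (ob z aff Z)) = wl x (tm f (𝟙 (ob z aff Z))) :=
  tm_assoc (𝟙 (ob z aff [x])) f (𝟙 (ob z aff Z))

theorem box_tm_id {a b c d : Strand} (f : ob z aff [a, b] ⟶ ob z aff [c, d])
    (W Z : List Strand) : tm (box f W) (𝟙 (ob z aff Z)) = box f (W ++ Z) :=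
  (tm_assoc f (𝟙 (ob z aff W)) (𝟙 (ob z aff Z))).trans (congrArg (tm f) (tm_id W Z))

theorem cap_tm_id (W Z : List Strand) : tm (cap W) (𝟙 (ob z aff Z)) = cap (W ++ Z) :=
  (tm_assoc (mor z capLeft) (𝟙 (ob z aff W)) (𝟙 (ob z aff Z))).trans
    (congrArg (tm (mor z capLeft)) (tm_id W Z))

theorem cup_tm_id (W Z : List Strand) : tm (cup W) (𝟙 (ob z aff Z)) = cup (W ++ Z) :=
  (tm_assoc (mor z cupLeft) (𝟙 (ob z aff W)) (𝟙 (ob z aff Z))).trans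
    (congrArg (tm (mor z cupLeft)) (tm_id W Z))

theorem tok_tm_id (W Z : List Strand) : tm (tok W) (𝟙 (ob z aff Z)) = tok (W ++ Z) :=
  (tm_assoc (mor z token) (𝟙 (ob z aff W)) (𝟙 (ob z aff Z))).trans
    (congrArg (tm (mor z token)) (tm_id W Z))

theorem cap_nil : cap [] = mor z (capLeft (aff := aff)) := tensHom_one (cls z capLeft)

theorem cup_nil : cup [] = mor z (cupLeft (aff := aff)) := tensHom_one (cls z cupLeft)

theorem tm_id_nil {X Y : List Strand} (f : ob z aff X ⟶ ob z aff Y) :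
    castHom (List.append_nil X) (List.append_nil Y) (tm f (𝟙 (ob z aff []))) = f :=
  tensHom_one f

theorem mor_eq {X Y : List Strand} {f g : Diagram aff X Y} (h : DefRel z aff (lin k f) (lin k g)) :
    mor z f = mor z g :=
  cls_eq (.rel h)

theorem mor_eq_zero {X Y : List Strand} {f : Diagram aff X Y} (h : DefRel z aff (lin k f) 0) :
    mor z f = 0 :=
  (Submodule.Quotient.eq _).2 (.rel h)

theorem posUp_negUp : mor z posUp ≫ mor z negUp = 𝟙 (ob z aff [up, up]) :=
  (mor_comp _ _).symm.trans (mor_eq (.pos_neg aff))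

theorem negUp_posUp : mor z negUp ≫ mor z posUp = 𝟙 (ob z aff [up, up]) :=
  (mor_comp _ _).symm.trans (mor_eq (.neg_pos aff))

theorem negRight_posLeft : mor z negRight ≫ mor z posLeft = 𝟙 (ob z aff [up, dn]) :=
  (mor_comp _ _).symm.trans (mor_eq (.right_left aff))

theorem posLeft_negRight : mor z posLeft ≫ mor z negRight = 𝟙 (ob z aff [dn, up]) :=
  (mor_comp _ _).symm.trans (mor_eq (.left_right aff))

theorem skein : mor z posUp = mor z negUp + z • 𝟙 (ob z aff [up, up]) := by
  have h : Vanishes z aff (lin k posUp - (lin k negUp + z • lin k (Diagram.id [up, up]))) := by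
    rw [← sub_sub]
    exact .rel (.skein aff)
  exact (Submodule.Quotient.eq (vanishing z aff _ _)).2 h

theorem token_sq : mor z token ≫ mor z token = -𝟙 (ob z aff [up]) :=
  (mor_comp _ _).symm.trans
    ((Submodule.Quotient.eq (vanishing z aff _ _)).2 (.rel (.token_sq aff)))

theorem bubble : mor z cupLeft ≫ mor z capRight = (0 : ob z aff [] ⟶ ob z aff []) :=
  (mor_comp _ _).symm.trans (mor_eq_zero (.bubble aff))

theorem tok_bubble :
    mor z cupLeft ≫ tok [dn] ≫ mor z capRight = (0 : ob z aff [] ⟶ ob z aff []) := by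
  refine Eq.trans ?_ (mor_eq_zero (.token_bubble aff))
  rw [mor_comp cupLeft, mor_comp (Diagram.tens token _), mor_tens]
  rfl

/-- The relation is first put into whiskered form with empty tail and then tensored on the right
with the identity of `Z`, which every whiskered factor absorbs. The other relations with a tail
arise in the same way. -/
theorem braid (Z : List Strand) :
    box (mor z (posUp (aff := aff))) (up :: Z) ≫ wl up (box (mor z posUp) Z) ≫
        box (mor z posUp) (up :: Z) =
      wl up (box (mor z posUp) Z) ≫ box (mor z posUp) (up :: Z) ≫ wl up (box (mor z posUp) Z) := by
  have h : box (mor z (posUp (aff := aff))) [up] ≫ wl up (box (mor z posUp) []) ≫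
        box (mor z posUp) [up] =
      wl up (box (mor z posUp) []) ≫ box (mor z posUp) [up] ≫ wl up (box (mor z posUp) []) := by
    have h := mor_eq (DefRel.braid (z := z) aff)
    simp only [mor_comp, mor_tens] at h
    rw [box_nil]
    exact h
  have h' := congrArg (fun f => tm f (𝟙 (ob z aff Z))) h
  simp only [comp_tm_id, box_tm_id, wl_tm_id] at h'
  exact h'

theorem tok_box (Z : List Strand) :
    tok (up :: Z) ≫ box (mor z (posUp (aff := aff))) Z = box (mor z posUp) Z ≫ wl up (tok Z) := by
  have h : tok [up] ≫ box (mor z (posUp (aff := aff))) [] =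
      box (mor z posUp) [] ≫ wl up (tok []) := by
    have h := mor_eq (DefRel.token_over (z := z) aff)
    simp only [mor_comp, mor_tens] at h
    rw [box_nil, tok_nil]
    exact h
  have h' := congrArg (fun f => tm f (𝟙 (ob z aff Z))) h
  simp only [comp_tm_id, box_tm_id, wl_tm_id, tok_tm_id] at h'
  exact h'

theorem zigzag_up (Z : List Strand) :
    cup (up :: Z) ≫ wl up (cap Z) = 𝟙 (ob z aff (up :: Z)) := by
  have h : cup [up] ≫ wl up (cap []) = 𝟙 (ob z aff [up]) := by
    have h := mor_eq (DefRel.zigzag_up (z := z) aff)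
    simp only [mor_comp, mor_tens] at h
    rw [cap_nil]
    exact h
  have h' := congrArg (fun f => tm f (𝟙 (ob z aff Z))) h
  simp only [comp_tm_id, wl_tm_id, cap_tm_id, cup_tm_id, tm_id] at h'
  exact h'

theorem zigzag_dn (Z : List Strand) :
    wl dn (cup Z) ≫ cap (dn :: Z) = 𝟙 (ob z aff (dn :: Z)) := by
  have h : wl dn (cup []) ≫ cap [dn] = 𝟙 (ob z aff [dn]) := by
    have h := mor_eq (DefRel.zigzag_dn (z := z) aff)
    simp only [mor_comp, mor_tens] at h
    rw [cup_nil]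
    exact h
  have h' := congrArg (fun f => tm f (𝟙 (ob z aff Z))) h
  simp only [comp_tm_id, wl_tm_id, cap_tm_id, cup_tm_id, tm_id] at h'
  exact h'

/-! # Rotation -/

/-- The rotation of a morphism `a ⊗ ↑ → ↑ ⊗ b` through a left cup and a left cap. -/
def rot {a b : Strand} (f : ob z aff [a, up] ⟶ ob z aff [up, b]) :
    ob z aff [dn, a] ⟶ ob z aff [b, dn] :=
  wl dn (wl a (cup [])) ≫ wl dn (box f [dn]) ≫ cap [b, dn]

theorem isEven_cap (Z : List Strand) : IsEven (cap Z : ob z aff (dn :: up :: Z) ⟶ ob z aff Z) :=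
  isEven_tm (isEven_mor rfl) (isEven_id Z)

theorem isEven_cup (Z : List Strand) : IsEven (cup Z : ob z aff Z ⟶ ob z aff (up :: dn :: Z)) :=
  isEven_tm (isEven_mor rfl) (isEven_id Z)

theorem IsEven.rot {a b : Strand} {f : ob z aff [a, up] ⟶ ob z aff [up, b]} (hf : IsEven f) :
    IsEven (rot f) :=
  (IsEven.wl dn (IsEven.wl a (isEven_cup []))).comp
    ((IsEven.wl dn (hf.box [dn])).comp (isEven_cap _))

theorem rot_add {a b : Strand} (f g : ob z aff [a, up] ⟶ ob z aff [up, b]) :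
    rot (f + g) = rot f + rot g := by
  simp only [rot, box, tm_add_left, wl_add, Preadditive.comp_add, Preadditive.add_comp]

theorem rot_smul {a b : Strand} (c : k) (f : ob z aff [a, up] ⟶ ob z aff [up, b]) :
    rot (c • f) = c • rot f := by
  simp only [rot, box, tm_smul_left, wl_smul, Linear.comp_smul, Linear.smul_comp]

theorem mor_rotate (f : Diagram aff [up, up] [up, up]) : mor z (rotate f) = rot (mor z f) := by
  simp only [rotate, mor_comp, mor_tens, rot, wl_wl, cup_nil]
  rfl

theorem box_rot {a b : Strand} (f : ob z aff [a, up] ⟶ ob z aff [up, b]) (Z : List Strand) :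
    box (rot f) Z =
      wl dn (wl a (cup Z)) ≫ wl dn (box f (dn :: Z)) ≫ cap (b :: dn :: Z) := by
  unfold rot
  refine (comp_tm_id Z _ _).trans ?_
  rw [wl_tm_id, wl_tm_id, cup_tm_id, comp_tm_id, wl_tm_id, box_tm_id, cap_tm_id]
  rfl

/-- Without a crossing the rotation falls apart into a cap followed by a cup. This is the correction
term in the rotated skein relation `posLeft_eq`. -/
theorem rot_id : rot (𝟙 (ob z aff [up, up])) = mor z capLeft ≫ mor z cupLeft := by
  rw [rot, box_id, wl_id, Category.id_comp, ← cap_naturality, cap_nil, cup_nil]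

/-- Moving the outer cap below `f` brings it next to the cup of the rotation, where the two form a
zigzag and straighten out. The cap of the rotation remains. -/
theorem rot_cap {a b : Strand} {f : ob z aff [a, up] ⟶ ob z aff [up, b]} (hf : IsEven f)
    (Z : List Strand) :
    box (rot f) (up :: Z) ≫ wl b (cap Z) = wl dn (box f Z) ≫ cap (b :: Z) := by
  rw [box_rot, Category.assoc, Category.assoc, cap_naturality, ← Category.assoc (wl dn (box f _)),
    ← wl_comp, box_wl_wl hf, wl_comp, Category.assoc, ← Category.assoc, ← wl_comp, ← wl_comp,
    zigzag_up, wl_id, wl_id, Category.id_comp]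

/-- Dual to `rot_cap`: the outer cup straightens against the cap of the rotation, and the cup of the
rotation remains. -/
theorem rot_cup {a b : Strand} {f : ob z aff [a, up] ⟶ ob z aff [up, b]}
    (Z : List Strand) :
    cup (a :: Z) ≫ wl up (box (rot f) Z) = wl a (cup Z) ≫ box f (dn :: Z) := by
  rw [box_rot, wl_comp, wl_comp, ← Category.assoc, cup_naturality, Category.assoc,
    ← Category.assoc (cup _), cup_naturality, Category.assoc, zigzag_up, Category.comp_id]

/-! # Passing an upward strand under a strand -/

theorem posLeft_eq : mor z (posLeft (aff := aff)) =
    mor z negLeft + z • (mor z capLeft ≫ mor z cupLeft) := by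
  rw [mor_rotate, mor_rotate, skein, rot_add, rot_smul, rot_id]

/-- Write $L^-=L-z\,\eta\varepsilon$ and $R^+=R^-+z\,R^-\eta\varepsilon R^-$. In either product with
$L=(R^-)^{-1}$ the two terms linear in $z$ cancel, and the quadratic term contains the bubble
$\varepsilon R^-\eta=0$. -/
theorem posRight_inv_aux {L : ob z aff [dn, up] ⟶ ob z aff [up, dn]}
    (hl : L ≫ mor z negRight = 𝟙 _) (hr : mor z negRight ≫ L = 𝟙 _)
    (h : L = mor z negLeft + z • (mor z capLeft ≫ mor z cupLeft)) :
    posRight z aff ≫ mor z negLeft = 𝟙 (ob z aff [up, dn]) ∧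
      mor z negLeft ≫ posRight z aff = 𝟙 (ob z aff [dn, up]) := by
  have hb : mor z cupLeft ≫ mor z negRight ≫ mor z capLeft = (0 : ob z aff [] ⟶ ob z aff []) := by
    rw [← mor_comp]; exact bubble
  rw [← sub_eq_iff_eq_add] at h
  rw [← h, posRight, show mor z (capRight (aff := aff)) = _ from mor_comp negRight capLeft,
    show mor z (cupRight (aff := aff)) = _ from mor_comp cupLeft negRight]
  constructor
  · simp only [Preadditive.add_comp, Preadditive.comp_sub, Linear.smul_comp, Linear.comp_smul,
      Category.assoc, hr, Category.comp_id, reassoc_of% hb, Limits.zero_comp,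
      Limits.comp_zero, smul_zero]
    simp
  · simp only [Preadditive.comp_add, Preadditive.sub_comp, Linear.smul_comp, Linear.comp_smul,
      Category.assoc, hl, reassoc_of% hl, reassoc_of% hb, Limits.zero_comp,
      Limits.comp_zero, smul_zero]
    simp

theorem posRight_negLeft : posRight z aff ≫ mor z negLeft = 𝟙 (ob z aff [up, dn]) :=
  (posRight_inv_aux posLeft_negRight negRight_posLeft posLeft_eq).1

theorem negLeft_posRight : mor z negLeft ≫ posRight z aff = 𝟙 (ob z aff [dn, up]) :=
  (posRight_inv_aux posLeft_negRight negRight_posLeft posLeft_eq).2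

theorem crossOne_crossOneBack : ∀ x : Strand,
    (crossOne z x : ob z false [up, x] ⟶ ob z false [x, up]) ≫ crossOneBack z x = 𝟙 _
  | up => negUp_posUp
  | dn => posRight_negLeft

theorem crossOneBack_crossOne : ∀ x : Strand,
    (crossOneBack z x : ob z false [x, up] ⟶ ob z false [up, x]) ≫ crossOne z x = 𝟙 _
  | up => posUp_negUp
  | dn => negLeft_posRight

theorem isEven_posRight : IsEven (posRight z aff) :=
  (isEven_mor rfl).add (((isEven_mor rfl).comp (isEven_mor rfl)).smul z)

theorem isEven_crossOne : ∀ x : Strand,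
    IsEven (crossOne z x : ob z false [up, x] ⟶ ob z false [x, up])
  | up => isEven_mor rfl
  | dn => isEven_posRight

theorem isEven_crossOneBack : ∀ x : Strand,
    IsEven (crossOneBack z x : ob z false [x, up] ⟶ ob z false [up, x])
  | up => isEven_mor rfl
  | dn => isEven_mor rfl

/-! # Passing an upward strand under all strands of a word -/

/-- The morphism `X ⊗ ↑ → ↑ ⊗ X` in which `X` passes over `↑`. -/
def under (X : List Strand) : ob z false (X ++ [up]) ⟶ ob z false (up :: X) := crossBack z X

/-- The morphism `↑ ⊗ X → X ⊗ ↑` in which `X` passes over `↑`. -/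
def underInv (X : List Strand) : ob z false (up :: X) ⟶ ob z false (X ++ [up]) := cross z X

/-- The morphism `x ⊗ ↑ → ↑ ⊗ x` in which `x` passes over `↑`. -/
def underOne (x : Strand) : ob z false [x, up] ⟶ ob z false [up, x] := crossOneBack z x

/-- The morphism `↑ ⊗ x → x ⊗ ↑` in which `x` passes over `↑`. -/
def underOneInv (x : Strand) : ob z false [up, x] ⟶ ob z false [x, up] := crossOne z x

theorem under_cons (x : Strand) (X : List Strand) :
    (under (x :: X) : ob z false (x :: (X ++ [up])) ⟶ _) =
      wl x (under X) ≫ box (underOne x) X := rfl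

theorem underInv_cons (x : Strand) (X : List Strand) :
    (underInv (x :: X) : _ ⟶ ob z false (x :: (X ++ [up]))) =
      box (underOneInv x) X ≫ wl x (underInv X) := rfl

theorem isEven_underOne (x : Strand) : IsEven (underOne (z := z) x) := isEven_crossOneBack x

theorem isEven_underOneInv (x : Strand) : IsEven (underOneInv (z := z) x) := isEven_crossOne x

theorem underOne_inv (x : Strand) : underOne (z := z) x ≫ underOneInv x = 𝟙 _ :=
  crossOneBack_crossOne x

theorem underOneInv_comp (x : Strand) : underOneInv (z := z) x ≫ underOne x = 𝟙 _ :=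
  crossOne_crossOneBack x

theorem isEven_under : ∀ X : List Strand, IsEven (under (z := z) X)
  | [] => isEven_id [up]
  | x :: X => ((isEven_under X).wl x).comp ((isEven_underOne x).box X)

theorem isEven_underInv : ∀ X : List Strand, IsEven (underInv (z := z) X)
  | [] => isEven_id [up]
  | x :: X => ((isEven_underOneInv x).box X).comp ((isEven_underInv X).wl x)

theorem under_inv : ∀ X : List Strand, under (z := z) X ≫ underInv X = 𝟙 _
  | [] => Category.id_comp _
  | x :: X => by
    refine (congrArg₂ (· ≫ ·) (under_cons x X) (underInv_cons x X)).trans ?_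
    change (wl x (under X) ≫ box (underOne x) X) ≫ box (underOneInv x) X ≫ wl x (underInv X) =
      𝟙 (ob z false (x :: (X ++ [up])))
    rw [Category.assoc, ← Category.assoc (box _ X), ← box_comp, underOne_inv, box_id,
      Category.id_comp, ← wl_comp, under_inv X, wl_id]

theorem underInv_comp : ∀ X : List Strand, underInv (z := z) X ≫ under X = 𝟙 _
  | [] => Category.id_comp _
  | x :: X => by
    refine (congrArg₂ (· ≫ ·) (underInv_cons x X) (under_cons x X)).trans ?_
    rw [Category.assoc, ← Category.assoc (wl x _), ← wl_comp, underInv_comp X, wl_id,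
      Category.id_comp, ← box_comp, underOneInv_comp, box_id]

/-! # Morphisms pass over the upward strand -/

/-- The strand `↑` can be passed under the morphism `f`. -/
def PassesOver {X Y : List Strand} (f : ob z false X ⟶ ob z false Y) : Prop :=
  tm f (𝟙 (ob z false [up])) ≫ under Y = under X ≫ wl up f

theorem PassesOver.id (X : List Strand) : PassesOver (𝟙 (ob z false X)) := by
  unfold PassesOver
  rw [tm_id, wl_id, Category.id_comp, Category.comp_id]

theorem PassesOver.comp {X Y Z : List Strand} {f : ob z false X ⟶ ob z false Y}
    {g : ob z false Y ⟶ ob z false Z} (hf : PassesOver f) (hg : PassesOver g) :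
    PassesOver (f ≫ g) := by
  unfold PassesOver at *
  rw [comp_tm_id, wl_comp, Category.assoc, hg, ← Category.assoc, hf, Category.assoc]

theorem PassesOver.zero {X Y : List Strand} :
    PassesOver (0 : ob z false X ⟶ ob z false Y) := by
  unfold PassesOver
  rw [tm_zero_left, wl_zero, Limits.zero_comp, Limits.comp_zero]

theorem PassesOver.add {X Y : List Strand} {f g : ob z false X ⟶ ob z false Y}
    (hf : PassesOver f) (hg : PassesOver g) : PassesOver (f + g) := by
  unfold PassesOver at *
  rw [tm_add_left, wl_add, Preadditive.add_comp, Preadditive.comp_add, hf, hg]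

theorem PassesOver.smul {X Y : List Strand} (c : k) {f : ob z false X ⟶ ob z false Y}
    (hf : PassesOver f) : PassesOver (c • f) := by
  unfold PassesOver at *
  rw [tm_smul_left, wl_smul, Linear.smul_comp, Linear.comp_smul, hf]

/-- The naturality square of an invertible morphism can be read backwards. This yields $N$ from $P$
and $R^-$ from $L^+$ without further relations. -/
theorem PassesOver.inv {X Y : List Strand} {f : ob z false X ⟶ ob z false Y}
    {g : ob z false Y ⟶ ob z false X} (hf : PassesOver f) (hfg : f ≫ g = 𝟙 _)
    (hgf : g ≫ f = 𝟙 _) : PassesOver g := by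
  unfold PassesOver at *
  have h : under X = tm f (𝟙 (ob z false [up])) ≫ under Y ≫ wl up g := by
    rw [← Category.assoc, hf, Category.assoc, ← wl_comp, hfg, wl_id, Category.comp_id]
  rw [h, ← Category.assoc, ← comp_tm_id, hgf, tm_id, Category.id_comp]

/-- The extra strand `x` contributes one more even crossing with `↑`, which takes place after `f`
has been passed and interchanges with it. -/
theorem PassesOver.wl (x : Strand) {X Y : List Strand} {f : ob z false X ⟶ ob z false Y}
    (hf : PassesOver f) : PassesOver (wl x f) := by
  unfold PassesOver at *
  rw [wl_tm_id]
  refine (congrArg (_ ≫ ·) (under_cons x Y)).trans ?_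
  refine Eq.trans ?_ (congrArg (· ≫ _) (under_cons x X)).symm
  rw [Category.assoc, box_wl_wl (isEven_underOne x), ← Category.assoc, ← wl_comp, hf, wl_comp,
    Category.assoc]

/-- Once the passage under `Z` has been interchanged with the crossing, what is left is the third
Reidemeister move, which is the braid relation. -/
theorem passesOver_posUp (Z : List Strand) : PassesOver (box (mor z posUp) Z) := by
  unfold PassesOver
  rw [box_tm_id]
  have h (Z : List Strand) : (under (up :: up :: Z) : ob z false (up :: up :: (Z ++ [up])) ⟶ _) =
      Isomeric.wl up (Isomeric.wl up (under Z)) ≫ Isomeric.wl up (box (mor z posUp) Z) ≫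
        box (mor z posUp) (up :: Z) := by
    refine (under_cons up (up :: Z)).trans ?_
    rw [← Category.assoc, ← wl_comp]
    rfl
  refine (congrArg (_ ≫ ·) (h Z)).trans ?_
  refine Eq.trans ?_ (congrArg (· ≫ _) (h Z)).symm
  rw [← Category.assoc, box_wl_wl (isEven_mor rfl), Category.assoc, braid, Category.assoc,
    Category.assoc]

theorem passesOver_negUp (Z : List Strand) : PassesOver (box (mor z negUp) Z) :=
  (passesOver_posUp Z).inv (by rw [← box_comp, posUp_negUp, box_id])
    (by rw [← box_comp, negUp_posUp, box_id])

/-- The over-strand of $P$ runs from bottom left to top right, so the relation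
$P(\tau\otimes1)=(1\otimes\tau)P$ slides a token along the strand passing over. -/
theorem passesOver_token (Z : List Strand) : PassesOver (tok Z : ob z false (up :: Z) ⟶ _) := by
  unfold PassesOver
  rw [tok_tm_id]
  refine (congrArg (_ ≫ ·) (under_cons up Z)).trans ?_
  refine Eq.trans ?_ (congrArg (· ≫ _) (under_cons up Z)).symm
  refine Eq.trans ?_ (Category.assoc _ _ _).symm
  refine Eq.trans ?_ (congrArg (Isomeric.wl up (under Z) ≫ ·) (tok_box Z))
  rw [← Category.assoc, tok_naturality (isEven_under Z), Category.assoc]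
  rfl

theorem rot_underOne_up : rot (underOne (z := z) up) = mor z posLeft := (mor_rotate posUp).symm

theorem underOne_dn : underOne (z := z) dn = rot (mor z negUp) := mor_rotate negUp

theorem under_up_dn (Z : List Strand) :
    (under (up :: dn :: Z) : ob z false (up :: dn :: (Z ++ [up])) ⟶ _) =
      Isomeric.wl up (Isomeric.wl dn (under Z)) ≫ Isomeric.wl up (box (underOne dn) Z) ≫
        box (mor z posUp) (dn :: Z) := by
  refine (under_cons up (dn :: Z)).trans ?_
  rw [← Category.assoc, ← wl_comp]
  rfl

theorem under_dn_up (Z : List Strand) :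
    (under (dn :: up :: Z) : ob z false (dn :: up :: (Z ++ [up])) ⟶ _) =
      Isomeric.wl dn (Isomeric.wl up (under Z)) ≫ Isomeric.wl dn (box (mor z posUp) Z) ≫
        box (underOne dn) (up :: Z) := by
  refine (under_cons dn (up :: Z)).trans ?_
  rw [← Category.assoc, ← wl_comp]
  rfl

/-- The crossing of `↓` over `↑` is the rotation of $N$. By `rot_cap` the cap turns it into $N$
itself, which cancels against the $P$ from the upward leg of the cap. -/
theorem passesOver_cap (Z : List Strand) : PassesOver (cap Z : ob z false (dn :: up :: Z) ⟶ _) := by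
  unfold PassesOver
  rw [cap_tm_id]
  refine Eq.trans ?_ (congrArg (· ≫ _) (under_dn_up Z)).symm
  rw [Category.assoc, Category.assoc, underOne_dn, rot_cap (isEven_mor rfl), ← Category.assoc
    (Isomeric.wl dn (box _ Z)), ← wl_comp, ← box_comp, posUp_negUp, box_id, wl_id,
    Category.id_comp, cap_naturality]

/-- As for the cap: `rot_cup` turns the crossing with the downward leg into $N$, which cancels
against $P$. -/
theorem passesOver_cup (Z : List Strand) : PassesOver (cup Z : _ ⟶ ob z false (up :: dn :: Z)) := by
  unfold PassesOver
  rw [cup_tm_id]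
  refine (congrArg (_ ≫ ·) (under_up_dn Z)).trans ?_
  rw [← Category.assoc, cup_naturality, Category.assoc, underOne_dn, ← Category.assoc (cup _),
    rot_cup, Category.assoc, ← box_comp, negUp_posUp, box_id, Category.comp_id]

/-- $L^+$ is a composite of a cup, a $P$ and a cap, each of which has been treated. -/
theorem passesOver_posLeft (Z : List Strand) : PassesOver (box (mor z posLeft) Z) := by
  rw [mor_rotate, box_rot]
  exact (((passesOver_cup Z).wl up).wl dn).comp
    (((passesOver_posUp (dn :: Z)).wl dn).comp (passesOver_cap _))

theorem passesOver_negRight (Z : List Strand) : PassesOver (box (mor z negRight) Z) :=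
  (passesOver_posLeft Z).inv (by rw [← box_comp, posLeft_negRight, box_id])
    (by rw [← box_comp, negRight_posLeft, box_id])

/-! ### Naturality of the passage under a word for all morphisms -/

theorem id_cons_tm (x : Strand) (X : List Strand) {Y Y' : List Strand}
    (f : ob z false Y ⟶ ob z false Y') :
    tm (𝟙 (ob z false (x :: X))) f = wl x (tm (𝟙 (ob z false X)) f) := by
  rw [← wl_id x X]
  exact tm_assoc (𝟙 (ob z false [x])) (𝟙 (ob z false X)) f

theorem PassesOver.id_tm {Y Y' : List Strand} {f : ob z false Y ⟶ ob z false Y'}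
    (hf : PassesOver f) : ∀ X : List Strand, PassesOver (tm (𝟙 (ob z false X)) f)
  | [] => by
    have h : tm (𝟙 (ob z false [])) f = f := tm_nil_left f
    exact (congrArg (PassesOver (X := Y) (Y := Y')) h).mpr hf
  | x :: X => by
    rw [id_cons_tm]
    exact (hf.id_tm X).wl x

theorem passesOver_castHom {X X' Y Y' : List Strand} (hX : X = X') (hY : Y = Y')
    {f : ob z false X ⟶ ob z false Y} :
    PassesOver (castHom hX hY f : ob z false X' ⟶ ob z false Y') ↔ PassesOver f := by
  subst hX; subst hY; rfl

/-- The induction on the diagram must allow an arbitrary tail `Z`: in a tensor product the left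
factor has the target of the right factor to its right. -/
theorem passesOver_mor_tm_id {X Y : List Strand} (f : Diagram false X Y) :
    ∀ Z : List Strand, PassesOver (tm (mor z f) (𝟙 (ob z false Z))) := by
  induction f with
  | gen g =>
    intro Z
    cases g with
    | posUp => exact passesOver_posUp Z
    | negUp => exact passesOver_negUp Z
    | negRight => exact passesOver_negRight Z
    | capLeft => exact passesOver_cap Z
    | cupLeft => exact passesOver_cup Z
    | token => exact passesOver_token Z
    | openToken h => exact absurd h Bool.false_ne_true
  | id X =>
    intro Z
    rw [mor_id, tm_id]
    exact .id _
  | comp f g hf hg =>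
    intro Z
    rw [mor_comp, comp_tm_id]
    exact (hf Z).comp (hg Z)
  | tens f g hf hg =>
    intro Z
    -- Splitting $f\otimes g$ as $1\otimes g$ followed by $f\otimes1$ requires no sign, even if both
    -- factors are odd.
    rw [mor_tens, ← passesOver_castHom (List.append_assoc _ _ _) (List.append_assoc _ _ _),
      tm_assoc, ← id_tm_comp_tm_id]
    exact ((hg Z).id_tm _).comp (hf _)

theorem passesOver {X Y : List Strand} (f : ob z false X ⟶ ob z false Y) : PassesOver f := by
  refine hom_induction (z := z) (X := X) (Y := Y)
    (P := fun f => PassesOver (z := z) (X := X) (Y := Y) f) .zero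
    (fun _ _ ha hb => ha.add hb) (fun c f => .smul c ?_) f
  have h := passesOver_mor_tm_id (z := z) f []
  rw [← passesOver_castHom (List.append_nil X) (List.append_nil Y), tm_id_nil] at h
  exact h

/-- Conjugate `passesOver` by the two mutually inverse passages. -/
theorem underInv_naturality {X Y : List Strand} (f : ob z false X ⟶ ob z false Y) :
    wl up f ≫ underInv Y = underInv X ≫ tm f (𝟙 (ob z false [up])) := by
  have h := congrArg (fun g => underInv X ≫ g ≫ underInv Y) (passesOver f)
  simp only [Category.assoc] at h
  rw [under_inv, Category.comp_id, ← Category.assoc (underInv X) (under X), underInv_comp,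
    Category.id_comp] at h
  exact h.symm

/-! # The collapsed open Clifford token -/

/-- The closed Clifford token on the right of `1_X`, brought to the left of `X`. -/
def otok (X : List Strand) : ob z false (up :: X) ⟶ ob z false (up :: X) := collapseToken z X

theorem otok_eq (X : List Strand) :
    otok (z := z) X = underInv X ≫ tm (𝟙 (ob z false X)) (mor z token) ≫ under X := rfl

theorem otok_nil : otok (z := z) [] = tok [] := by
  have h := tm_nil_left (mor z (token (aff := false)))
  refine (Category.id_comp _).trans ((Category.comp_id _).trans ?_)
  exact h.trans tok_nil.symm

/-- The recursions for the two passages nest around the token, so adding a strand conjugates by a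
single crossing. Every later induction on the word rests on this. -/
theorem otok_cons (x : Strand) (X : List Strand) :
    otok (z := z) (x :: X) = box (underOneInv x) X ≫ wl x (otok X) ≫ box (underOne x) X := by
  refine (otok_eq (x :: X)).trans ?_
  rw [id_cons_tm]
  refine (congrArg₂ (fun f g => f ≫ _ ≫ g) (underInv_cons x X) (under_cons x X)).trans ?_
  rw [otok_eq, wl_comp, wl_comp]
  simp only [Category.assoc]

theorem hasParity_otok (X : List Strand) : HasParity 1 (otok (z := z) X) := by
  have h : HasParity (0 + ((0 + 1) + 0)) (otok (z := z) X) :=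
    compHom_mem (isEven_underInv X) (compHom_mem
      (tensHom_mem (isEven_id X) (cls_mem (f := token) rfl)) (isEven_under X))
  simpa using h

/-- A conjugate of $1_X\otimes\tau$ squares to the conjugate of $1_X\otimes\tau^2=-1$. -/
theorem otok_sq (X : List Strand) : otok (z := z) X ≫ otok X = -𝟙 _ := by
  have h : tm (𝟙 (ob z false X)) (mor z token) ≫ tm (𝟙 (ob z false X)) (mor z token) = -𝟙 _ := by
    rw [← id_tm_comp, token_sq, ← neg_one_smul k, tm_smul_right, tm_id, neg_one_smul]
  rw [otok_eq]
  simp only [Category.assoc]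
  rw [reassoc_of% under_inv X, reassoc_of% h, Preadditive.neg_comp, Category.id_comp,
    Preadditive.comp_neg, underInv_comp]

/-- The passages are natural without sign, so the only sign is the one from interchanging `f` with
the token to the right of `X`. -/
theorem otok_naturality {X Y : List Strand} {q : ZMod 2} {f : ob z false X ⟶ ob z false Y}
    (hf : HasParity q f) : otok X ≫ wl up f = koszul k 1 q • (wl up f ≫ otok Y) := by
  have h : tm (𝟙 (ob z false X)) (mor z token) ≫ tm f (𝟙 _) =
      koszul k 1 q • (tm f (𝟙 _) ≫ tm (𝟙 (ob z false Y)) (mor z token)) := by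
    -- Interchange puts the sign on the opposite side of the equation; being $\pm1$, it is its own
    -- inverse.
    have hk : koszul k 1 q * koszul k q 1 = 1 := by
      rw [koszul, koszul, mul_comm q.val, ← mul_pow]; simp
    have ht : HasParity 1 (mor z (token (aff := false))) := cls_mem rfl
    rw [id_tm_comp_tm_id, tm_interchange _ _ hf ht, smul_smul, hk,
      one_smul, Category.id_comp, Category.comp_id]
  rw [otok_eq, otok_eq, ← Category.assoc (wl up f), underInv_naturality]
  simp only [Category.assoc]
  rw [← passesOver f, reassoc_of% h, Linear.smul_comp, Linear.comp_smul, Category.assoc]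

/-! # Passing a downward strand under two strands -/

theorem under_pair (a b : Strand) :
    (under [a, b] : ob z false [a, b, up] ⟶ _) =
      wl a (box (underOne b) []) ≫ box (underOne a) [b] := by
  refine (under_cons a [b]).trans ?_
  have h : (under [b] : ob z false [b, up] ⟶ _) = box (underOne b) [] :=
    (under_cons b []).trans ((congrArg (· ≫ _) (wl_id b [up])).trans (Category.id_comp _))
  exact congrArg (fun g => wl a g ≫ box (underOne a) [b]) h

/-- Naturality for two strands with the two crossings displayed separately and a tail added; in this
form it can be rotated. -/
theorem box_passesOver {a b c d : Strand} (f : ob z false [a, b] ⟶ ob z false [c, d])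
    (Z : List Strand) :
    box f (up :: Z) ≫ wl c (box (underOne d) Z) ≫ box (underOne c) (d :: Z) =
      wl a (box (underOne b) Z) ≫ box (underOne a) (b :: Z) ≫ wl up (box f Z) := by
  have h : box f [up] ≫ wl c (box (underOne d) []) ≫ box (underOne c) [d] =
      wl a (box (underOne b) []) ≫ box (underOne a) [b] ≫ wl up (box f []) := by
    have h := passesOver f
    unfold PassesOver at h
    rw [box_nil f]
    refine ((congrArg (box f [up] ≫ ·) (under_pair c d)).symm.trans h).trans ?_
    exact (congrArg (· ≫ wl up f) (under_pair a b)).trans (Category.assoc _ _ _)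
  have h' := congrArg (fun f => tm f (𝟙 (ob z false Z))) h
  simp only [comp_tm_id, box_tm_id, wl_tm_id] at h'
  exact h'

/-- The morphism `↓ ⊗ x → x ⊗ ↓` in which `x` passes over `↓`. -/
def underDown (x : Strand) : ob z false [dn, x] ⟶ ob z false [x, dn] := rot (underOne x)

theorem isEven_underDown (x : Strand) : IsEven (underDown (z := z) x) := (isEven_underOne x).rot

theorem underDown_up : underDown (z := z) up = mor z posLeft := rot_underOne_up

/-- Two successive rotated crossings amount to one rotation: the intermediate cup and cap
straighten, and a single `↑` passes under both strands between the outer cup and cap. -/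
theorem underDown_pair (a b : Strand) (Z : List Strand) :
    box (underDown (z := z) a) (b :: Z) ≫ wl a (box (underDown b) Z) =
      wl dn (wl a (wl b (cup Z)) ≫ wl a (box (underOne b) (dn :: Z)) ≫
        box (underOne a) (b :: dn :: Z)) ≫ cap (a :: b :: dn :: Z) := by
  have h₁ : cup (b :: Z) ≫ wl up (box (underDown (z := z) b) Z) =
      wl b (cup Z) ≫ box (underOne b) (dn :: Z) := rot_cup Z
  rw [underDown, box_rot]
  simp only [Category.assoc]
  rw [cap_naturality, ← Category.assoc (wl dn (box _ _)), ← wl_comp,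
    box_wl_wl (isEven_underOne a), wl_comp, Category.assoc, ← Category.assoc (wl dn (wl a (cup _))),
    ← wl_comp, ← wl_comp, h₁]
  simp only [wl_comp, Category.assoc]

/-- After both crossings have been merged by `underDown_pair`, this is `box_passesOver` enclosed
between a cup and a cap, which `f` interchanges with. -/
theorem underDown_naturality {a b c d : Strand} {f : ob z false [a, b] ⟶ ob z false [c, d]}
    (hf : IsEven f) (Z : List Strand) :
    wl dn (box f Z) ≫ box (underDown c) (d :: Z) ≫ wl c (box (underDown d) Z) =
      box (underDown a) (b :: Z) ≫ wl a (box (underDown b) Z) ≫ box f (dn :: Z) := by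
  rw [underDown_pair, ← Category.assoc (box (underDown a) _), underDown_pair, Category.assoc,
    cap_naturality, ← Category.assoc, ← wl_comp, ← Category.assoc (wl dn _), ← wl_comp,
    ← Category.assoc (box f Z), box_wl_wl hf]
  simp only [Category.assoc]
  rw [box_passesOver]

/-! # Clockwise circles -/

theorem box_negRight_posLeft (Z : List Strand) :
    box (mor z negRight) Z ≫ box (mor z posLeft) Z = 𝟙 (ob z false (up :: dn :: Z)) := by
  rw [← box_comp, negRight_posLeft, box_id]

theorem box_posLeft_negRight (Z : List Strand) :
    box (mor z posLeft) Z ≫ box (mor z negRight) Z = 𝟙 (ob z false (dn :: up :: Z)) := by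
  rw [← box_comp, posLeft_negRight, box_id]

/-- The right cup on the left of `1_Z`. -/
def rcup (Z : List Strand) : ob z false Z ⟶ ob z false (dn :: up :: Z) :=
  cup Z ≫ box (mor z negRight) Z

/-- A right cup can be pulled under the strand `x`. The right cup is a left cup followed by $R^-$,
so after composing with $L^+=(R^-)^{-1}$ the claim concerns a left cup, for which `rot_cup` applies.
Moving $L^+$ through the crossings with `x` is `underDown_naturality` for the crossing of `x` over
`↑`. -/
theorem rcup_underDown (x : Strand) (Z : List Strand) :
    rcup (x :: Z) ≫ wl dn (box (underOneInv x) Z) ≫ box (underDown x) (up :: Z) =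
      wl x (rcup (z := z) Z) := by
  have hu := underDown_naturality (isEven_underOne (z := z) x) Z
  rw [underDown_up] at hu
  have hs : wl dn (box (underOneInv x) Z) ≫ wl dn (box (underOne (z := z) x) Z) = 𝟙 _ := by
    rw [← wl_comp, ← box_comp, underOneInv_comp, box_id, wl_id]
  have hs' : box (underOne (z := z) x) (dn :: Z) ≫ box (underOneInv x) (dn :: Z) = 𝟙 _ := by
    rw [← box_comp, underOne_inv, box_id]
  have hc : cup (x :: Z) ≫ wl up (box (underDown (z := z) x) Z) =
      wl x (cup Z) ≫ box (underOne x) (dn :: Z) := rot_cup Z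
  have hu' : wl dn (box (underOneInv x) Z) ≫ box (underDown x) (up :: Z) ≫
      wl x (box (mor z posLeft) Z) =
      box (mor z posLeft) (x :: Z) ≫ wl up (box (underDown x) Z) ≫
        box (underOneInv x) (dn :: Z) := by
    -- The naturality relation is conjugated by the inverse crossings of `x` with `↑` so that $L^+$
    -- moves to the bottom, next to the right cup.
    have h := congrArg (fun g => wl dn (box (underOneInv x) Z) ≫ g ≫ box (underOneInv x) (dn :: Z))
      hu
    simp only [Category.assoc] at h
    rw [hs', Category.comp_id, reassoc_of% hs] at h
    exact h.symm
  have key : (rcup (x :: Z) ≫ wl dn (box (underOneInv x) Z) ≫ box (underDown x) (up :: Z)) ≫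
      wl x (box (mor z posLeft) Z) = wl x (cup (z := z) Z) := by
    rw [rcup]
    simp only [Category.assoc]
    rw [hu', reassoc_of% box_negRight_posLeft (x :: Z), reassoc_of% hc, hs', Category.comp_id]
  -- Cancel the auxiliary $L^+$ with $R^-$ to recover the right cup on the other side.
  have h := congrArg (· ≫ wl x (box (mor z negRight) Z)) key
  simp only [Category.assoc] at h
  rw [← wl_comp, box_posLeft_negRight, wl_id, Category.comp_id, ← wl_comp] at h
  exact h

/-- The upward strand is the over-strand of $L^+$, which is a rotation of $P$. Inside the rotation
the token slides through $P$ by `tok_box` and past the cup by interchange. -/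
theorem tok_posLeft (Z : List Strand) :
    box (mor z posLeft) Z ≫ tok (dn :: Z) =
      wl dn (tok Z) ≫ box (mor z (posLeft (aff := false))) Z := by
  have h₁ : wl up (cup Z) ≫ tok (up :: dn :: Z) = tok Z ≫ wl up (cup (z := z) (aff := false) Z) :=
    (tok_naturality (isEven_cup Z)).symm
  rw [mor_rotate, box_rot, Category.assoc, Category.assoc, cap_naturality,
    ← Category.assoc (wl dn (box _ _)), ← wl_comp, ← tok_box, wl_comp, Category.assoc,
    ← Category.assoc (wl dn (wl up _)), ← wl_comp, h₁, wl_comp, Category.assoc]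

/-- Sliding the token down through the $R^-$ of the right cup gives the relation
$\varepsilon'(\tau\otimes1_\downarrow)\eta=0$. -/
theorem circle_otok_nil : rcup [] ≫ wl dn (otok []) ≫ cap (z := z) [] = 0 := by
  have h : box (mor z negRight) [] ≫ wl dn (tok (z := z) (aff := false) []) =
      tok [dn] ≫ box (mor z negRight) [] := by
    have h := congrArg (fun g => box (mor z negRight) [] ≫ g ≫ box (mor z negRight) [])
      (tok_posLeft (z := z) [])
    simp only [Category.assoc] at h
    rw [box_posLeft_negRight, Category.comp_id, reassoc_of% box_negRight_posLeft []] at h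
    exact h.symm
  rw [rcup, otok_nil, Category.assoc, reassoc_of% h, box_nil, cap_nil, cup_nil, ← mor_comp negRight]
  exact tok_bubble

/-- By `otok_cons` the upward side of the circle crosses the strand `x` twice. The upper crossing is
moved through the cap to the downward side; the circle then starts with a right cup pulled under
`x`, and the induction hypothesis applies to the right of `x`. -/
theorem circle_otok : ∀ X : List Strand, rcup X ≫ wl dn (otok X) ≫ cap (z := z) X = 0
  | [] => circle_otok_nil
  | x :: X => by
    have h : wl dn (box (underOne (z := z) x) X) ≫ cap (x :: X) =
        box (underDown x) (up :: X) ≫ wl x (cap X) := (rot_cap (isEven_underOne x) X).symm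
    rw [otok_cons, wl_comp, wl_comp]
    simp only [Category.assoc]
    rw [h, ← Category.assoc (wl dn (wl x _)), ← box_wl_wl (isEven_underDown x)]
    have h' := rcup_underDown (z := z) x X
    simp only [Category.assoc] at h' ⊢
    rw [reassoc_of% h', ← wl_comp, ← wl_comp, circle_otok X, wl_zero]

/-! # The relations of the open Clifford token -/

theorem bubble_tail (Z : List Strand) :
    cup Z ≫ box (mor z negRight) Z ≫ cap Z = (0 : ob z false Z ⟶ ob z false Z) := by
  have h : cup [] ≫ box (mor z negRight) [] ≫ cap [] = (0 : ob z false [] ⟶ ob z false []) := by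
    rw [box_nil, cap_nil, cup_nil, ← mor_comp negRight]
    exact bubble
  have h' := congrArg (fun f => tm f (𝟙 (ob z false Z))) h
  simp only [comp_tm_id, box_tm_id, cap_tm_id, cup_tm_id, tm_zero_left] at h'
  exact h'

theorem box_posRight (Z : List Strand) : box (posRight z false) Z =
    box (mor z negRight) Z +
      z • (box (mor z negRight) Z ≫ cap Z ≫ cup Z ≫ box (mor z negRight) Z) := by
  rw [posRight, box, tm_add_left, tm_smul_left, comp_tm_id, mor_comp negRight, mor_comp cupLeft]
  congr 2
  refine (congrArg₂ (· ≫ ·) (comp_tm_id Z _ _) (comp_tm_id Z _ _)).trans ?_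
  exact Category.assoc _ _ _

/-- $R^+$ and $R^-$ differ by a term that starts with a right cap, and this closes the cup into a
vanishing bubble. -/
theorem cup_posRight (Z : List Strand) : cup Z ≫ box (posRight z false) Z = rcup Z := by
  rw [box_posRight, Preadditive.comp_add, Linear.comp_smul, reassoc_of% bubble_tail Z,
    Limits.zero_comp, smul_zero, add_zero, rcup]

theorem box_posLeft (Z : List Strand) : box (mor z posLeft) Z =
    box (mor z negLeft) Z + z • (cap Z ≫ cup (z := z) (aff := false) Z) := by
  rw [posLeft_eq, box, tm_add_left, tm_smul_left, comp_tm_id]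
  rfl

/-- For $L^+$ in place of $L^-$ this is the cancellation with $R^-$; the difference of the two
crossings contributes a vanishing bubble. -/
theorem negLeft_rcap (Z : List Strand) :
    box (mor z negLeft) Z ≫ box (mor z negRight) Z ≫ cap Z = cap (z := z) (aff := false) Z := by
  rw [eq_sub_of_add_eq (box_posLeft (z := z) Z).symm, Preadditive.sub_comp, reassoc_of% box_posLeft_negRight Z,
    Linear.smul_comp, Category.assoc, bubble_tail, Limits.comp_zero, smul_zero, sub_zero]

/-- Peeling off the downward strand puts $R^+$ on the cup and $L^-$ under the right cap. Both are
absorbed, and what remains is the circle of `circle_otok`. -/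
theorem otok_bubble (Z : List Strand) :
    cup Z ≫ otok (dn :: Z) ≫ box (mor z negRight) Z ≫ cap Z = 0 := by
  rw [otok_cons]
  simp only [Category.assoc]
  have h₁ : box (underOne (z := z) dn) Z ≫ box (mor z negRight) Z ≫ cap Z = cap Z :=
    negLeft_rcap Z
  have h₂ : cup Z ≫ box (underOneInv (z := z) dn) Z = rcup Z := cup_posRight Z
  rw [h₁, reassoc_of% h₂, circle_otok]

/-- The open token on one more upward strand is a conjugate by $N$ and $P$, so composing with $P$
below cancels $N$. -/
theorem otok_box_posUp (Z : List Strand) :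
    wl up (otok Z) ≫ box (mor z posUp) Z = box (mor z posUp) Z ≫ otok (up :: Z) := by
  have h : box (mor z posUp) Z ≫ box (underOneInv (z := z) up) Z = 𝟙 _ := by
    refine (box_comp _ _ Z).symm.trans ?_
    exact (congrArg (box · Z) (posUp_negUp (z := z) (aff := false))).trans (box_id up up Z)
  rw [otok_cons, reassoc_of% h]
  rfl

end Isomeric

/-! # Interpretations of formal diagrams in strict monoidal supercategories -/

/-! ### Transport along equalities of objects -/

theorem eqToHom_conj₃ {C : Type w} [Category.{v} C]
    {X X₁ X₂ X₃ Y Y₁ Y₂ Y₃ : C} (h₀ : X₃ = X₂) (h₁ : X₂ = X₁) (h₂ : X₁ = X)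
    (f : X ⟶ Y) (h₃ : Y = Y₁) (h₄ : Y₁ = Y₂) (h₅ : Y₂ = Y₃) :
    eqToHom h₀ ≫ (eqToHom h₁ ≫ (eqToHom h₂ ≫ f ≫ eqToHom h₃) ≫ eqToHom h₄) ≫ eqToHom h₅ =
      eqToHom (h₀.trans (h₁.trans h₂)) ≫ f ≫ eqToHom (h₃.trans (h₄.trans h₅)) := by
  simp

section EqToHom

open StrictMonoidalSupercategory

variable {k : Type u} [CommRing k]
  {B : Type w} [Category.{v} B] [Preadditive B] [Linear k B] [Supercategory k B]

theorem eqToHom_comp_mem {p : ZMod 2} {X X' Y Y' : B} (hX : X' = X) (hY : Y = Y') {f : X ⟶ Y}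
    (hf : f ∈ Supercategory.part (k := k) p X Y) :
    eqToHom hX ≫ f ≫ eqToHom hY ∈ Supercategory.part (k := k) p X' Y' := by
  subst hX; subst hY
  simpa using hf

variable [Monoid B] [StrictMonoidalSupercategory k B]

theorem tensor_eqToHom {X₁ X₂ X₃ X₄ Y₁ Y₂ Y₃ Y₄ : B} (hX : X₁ = X₂) (hX' : X₃ = X₄)
    (hY : Y₁ = Y₂) (hY' : Y₃ = Y₄) (f : X₂ ⟶ X₃) (g : Y₂ ⟶ Y₃) :
    tensor (k := k) (eqToHom hX ≫ f ≫ eqToHom hX') (eqToHom hY ≫ g ≫ eqToHom hY') =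
      eqToHom (congrArg₂ (· * ·) hX hY) ≫ tensor (k := k) f g ≫
        eqToHom (congrArg₂ (· * ·) hX' hY') := by
  subst hX; subst hX'; subst hY; subst hY'
  simp

theorem tensor_eqToHom_left {X₁ X₂ X₃ X₄ Y Y' : B} (hX : X₁ = X₂) (hX' : X₃ = X₄)
    (f : X₂ ⟶ X₃) (g : Y ⟶ Y') :
    tensor (k := k) (eqToHom hX ≫ f ≫ eqToHom hX') g =
      eqToHom (congrArg (· * Y) hX) ≫ tensor (k := k) f g ≫ eqToHom (congrArg (· * Y') hX') := by
  subst hX; subst hX'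
  simp

theorem tensor_eqToHom_right {X X' Y₁ Y₂ Y₃ Y₄ : B} (hY : Y₁ = Y₂) (hY' : Y₃ = Y₄)
    (f : X ⟶ X') (g : Y₂ ⟶ Y₃) :
    tensor (k := k) f (eqToHom hY ≫ g ≫ eqToHom hY') =
      eqToHom (congrArg (X * ·) hY) ≫ tensor (k := k) f g ≫ eqToHom (congrArg (X' * ·) hY') := by
  subst hY; subst hY'
  simp

/-- An interpretation sends the empty word to an object that is only propositionally the unit, so
the unit law has to be transported. -/
theorem id_tensor_of_eq_one {U X Y : B} (hU : U = 1) (f : X ⟶ Y) :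
    tensor (k := k) (𝟙 U) f =
      eqToHom (by rw [hU, one_mul]) ≫ f ≫ eqToHom (by rw [hU, one_mul]) := by
  subst hU
  exact one_tensor f

theorem tensor_id_of_eq_one {U X Y : B} (hU : U = 1) (f : X ⟶ Y) :
    tensor (k := k) f (𝟙 U) =
      eqToHom (by rw [hU, mul_one]) ≫ f ≫ eqToHom (by rw [hU, mul_one]) := by
  subst hU
  exact tensor_one f

theorem tensor_zero {X Y X' Y' : B} (f : X ⟶ Y) :
    tensor (k := k) f (0 : X' ⟶ Y') = 0 := by
  have h := tensor_smul (k := k) 0 f (0 : X' ⟶ Y')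
  rwa [zero_smul, zero_smul] at h

theorem zero_tensor {X Y X' Y' : B} (g : X' ⟶ Y') :
    tensor (k := k) (0 : X ⟶ Y) g = 0 := by
  have h := smul_tensor (k := k) 0 (0 : X ⟶ Y) g
  rwa [zero_smul, zero_smul] at h

end EqToHom

open StrictMonoidalSupercategory Isomeric

/-- Images of the objects and of the generating morphisms in a strict monoidal supercategory. -/
structure Interpretation (k : Type u) [CommRing k] (aff : Bool)
    (B : Type w) [Category.{v} B] [Preadditive B] [Linear k B] [Supercategory k B] [Monoid B]
    [StrictMonoidalSupercategory k B] where
  obj : List Strand → B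
  obj_nil : obj [] = 1
  obj_append : ∀ X Y, obj (X ++ Y) = obj X * obj Y
  gen : ∀ {X Y : List Strand}, Gen aff X Y → (obj X ⟶ obj Y)
  gen_mem : ∀ {X Y : List Strand} (g : Gen aff X Y),
    gen g ∈ Supercategory.part (k := k) g.parity (obj X) (obj Y)

namespace Interpretation

variable {k : Type u} [CommRing k] {aff : Bool}
  {B : Type w} [Category.{v} B] [Preadditive B] [Linear k B] [Supercategory k B] [Monoid B]
  [StrictMonoidalSupercategory k B] (I : Interpretation k aff B)

/-- The value of a diagram. -/
def eval : ∀ {X Y : List Strand}, Diagram aff X Y → (I.obj X ⟶ I.obj Y)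
  | _, _, .gen g => I.gen g
  | _, _, .id X => 𝟙 (I.obj X)
  | _, _, .comp f g => eval f ≫ eval g
  | _, _, .tens f g => eqToHom (I.obj_append _ _) ≫ tensor (k := k) (eval f) (eval g) ≫
      eqToHom (I.obj_append _ _).symm

theorem eval_id (X : List Strand) : I.eval (.id X) = 𝟙 (I.obj X) := rfl

theorem eval_comp {X Y Z : List Strand} (f : Diagram aff X Y) (g : Diagram aff Y Z) :
    I.eval (.comp f g) = I.eval f ≫ I.eval g := rfl

theorem eval_tens {X Y X' Y' : List Strand} (f : Diagram aff X Y) (g : Diagram aff X' Y') :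
    I.eval (.tens f g) = eqToHom (I.obj_append _ _) ≫ tensor (k := k) (I.eval f) (I.eval g) ≫
      eqToHom (I.obj_append _ _).symm := rfl

theorem eval_cast {X X' Y Y' : List Strand} (hX : X = X') (hY : Y = Y') (f : Diagram aff X Y) :
    I.eval (f.cast hX hY) =
      eqToHom (congrArg I.obj hX.symm) ≫ I.eval f ≫ eqToHom (congrArg I.obj hY) := by
  subst hX; subst hY
  simp [Diagram.cast]

theorem eval_mem {X Y : List Strand} (f : Diagram aff X Y) :
    I.eval f ∈ Supercategory.part (k := k) f.parity (I.obj X) (I.obj Y) := by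
  induction f with
  | gen g => exact I.gen_mem g
  | id X => exact Supercategory.id_mem _
  | comp f g hf hg => exact Supercategory.comp_mem hf hg
  | tens f g hf hg => exact eqToHom_comp_mem _ _ (tensor_mem hf hg)

/-- The value of a linear combination of diagrams. -/
def evalLin (X Y : List Strand) : LinDiagram k aff X Y →ₗ[k] (I.obj X ⟶ I.obj Y) :=
  Finsupp.linearCombination k fun f => I.eval f

theorem evalLin_lin {X Y : List Strand} (f : Diagram aff X Y) :
    I.evalLin X Y (lin k f) = I.eval f := by
  simp [evalLin, Finsupp.linearCombination_single]

theorem evalLin_comp_left {X Y Z : List Strand} (f : Diagram aff X Y) (l : LinDiagram k aff Y Z) :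
    I.evalLin X Z (l.mapDomain fun g => .comp f g) = I.eval f ≫ I.evalLin Y Z l := by
  induction l using lin_induction with
  | h0 => simp
  | hadd l m hl hm => rw [Finsupp.mapDomain_add, map_add, map_add, hl, hm, Preadditive.comp_add]
  | hlin c g =>
    rw [Finsupp.mapDomain_smul, Finsupp.mapDomain_single, map_smul, map_smul, evalLin_lin,
      evalLin_lin, Linear.comp_smul, eval_comp]

theorem evalLin_comp_right {X Y Z : List Strand} (g : Diagram aff Y Z) (l : LinDiagram k aff X Y) :
    I.evalLin X Z (l.mapDomain fun f => .comp f g) = I.evalLin X Y l ≫ I.eval g := by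
  induction l using lin_induction with
  | h0 => simp
  | hadd l m hl hm => rw [Finsupp.mapDomain_add, map_add, map_add, hl, hm, Preadditive.add_comp]
  | hlin c g =>
    rw [Finsupp.mapDomain_smul, Finsupp.mapDomain_single, map_smul, map_smul, evalLin_lin,
      evalLin_lin, Linear.smul_comp, eval_comp]

theorem evalLin_tens_left {X Y X' Y' : List Strand} (f : Diagram aff X Y)
    (l : LinDiagram k aff X' Y') :
    I.evalLin _ _ (l.mapDomain fun g => .tens f g) =
      eqToHom (I.obj_append _ _) ≫ tensor (k := k) (I.eval f) (I.evalLin X' Y' l) ≫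
        eqToHom (I.obj_append _ _).symm := by
  induction l using lin_induction with
  | h0 => simp [tensor_zero]
  | hadd l m hl hm =>
    rw [Finsupp.mapDomain_add, map_add, map_add, hl, hm, tensor_add, Preadditive.add_comp,
      Preadditive.comp_add]
  | hlin c g =>
    rw [Finsupp.mapDomain_smul, Finsupp.mapDomain_single, map_smul, map_smul, evalLin_lin,
      evalLin_lin, tensor_smul, Linear.smul_comp, Linear.comp_smul, eval_tens]

theorem evalLin_tens_right {X Y X' Y' : List Strand} (g : Diagram aff X' Y')
    (l : LinDiagram k aff X Y) :
    I.evalLin _ _ (l.mapDomain fun f => .tens f g) =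
      eqToHom (I.obj_append _ _) ≫ tensor (k := k) (I.evalLin X Y l) (I.eval g) ≫
        eqToHom (I.obj_append _ _).symm := by
  induction l using lin_induction with
  | h0 => simp [zero_tensor]
  | hadd l m hl hm =>
    rw [Finsupp.mapDomain_add, map_add, map_add, hl, hm, add_tensor, Preadditive.add_comp,
      Preadditive.comp_add]
  | hlin c g =>
    rw [Finsupp.mapDomain_smul, Finsupp.mapDomain_single, map_smul, map_smul, evalLin_lin,
      evalLin_lin, smul_tensor, Linear.smul_comp, Linear.comp_smul, eval_tens]

/-- The defining relations hold. -/
def Respects (z : k) : Prop :=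
  ∀ ⦃X Y : List Strand⦄ ⦃l r : LinDiagram k aff X Y⦄, DefRel z aff l r →
    I.evalLin X Y l = I.evalLin X Y r

/-! ### Descent of the evaluation to the presented supercategory -/

variable {I} {z : k}

/-- The clauses of `Vanishes` are bilinearity, the axioms of a strict monoidal supercategory and the
defining relations. The target satisfies the former, and the last are the hypothesis. -/
theorem Respects.vanishes (hI : I.Respects z) {X Y : List Strand} {l : LinDiagram k aff X Y}
    (h : Vanishes z aff l) : I.evalLin X Y l = 0 := by
  induction h with
  | zero => exact map_zero _
  | add _ _ h₁ h₂ => rw [map_add, h₁, h₂, add_zero]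
  | smul c _ h => rw [map_smul, h, smul_zero]
  | comp_left f _ h => rw [evalLin_comp_left, h, Limits.comp_zero]
  | comp_right f _ h => rw [evalLin_comp_right, h, Limits.zero_comp]
  | tens_left f _ h =>
    rw [evalLin_tens_left, h, tensor_zero, Limits.zero_comp, Limits.comp_zero]
  | tens_right f _ h =>
    rw [evalLin_tens_right, h, zero_tensor, Limits.zero_comp, Limits.comp_zero]
  | id_comp f =>
    rw [map_sub, evalLin_lin, evalLin_lin, eval_comp, eval_id, Category.id_comp, sub_self]
  | comp_id f =>
    rw [map_sub, evalLin_lin, evalLin_lin, eval_comp, eval_id, Category.comp_id, sub_self]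
  | comp_assoc f g h =>
    simp only [map_sub, evalLin_lin, eval_comp, Category.assoc, sub_self]
  | tens_id X Y =>
    rw [map_sub, evalLin_lin, evalLin_lin, eval_tens, eval_id, eval_id, eval_id, tensor_id]
    simp
  | interchange f f' g' g =>
    -- The sign in the target is the formal one because evaluation preserves parity (`eval_mem`).
    have h := interchange (I.eval f') (I.eval g') (I.eval_mem f) (I.eval_mem g)
    simp only [map_sub, map_smul, evalLin_lin, eval_comp, eval_tens, Category.assoc,
      eqToHom_trans_assoc, eqToHom_refl, Category.id_comp]
    rw [reassoc_of% h, Linear.smul_comp, Linear.comp_smul, sub_self]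
  | tens_assoc f g h =>
    rw [map_sub, evalLin_lin, evalLin_lin, eval_cast, eval_tens, eval_tens, eval_tens, eval_tens,
      tensor_eqToHom_left, tensor_eqToHom_right, tensor_assoc]
    simp
  | one_tens f =>
    rw [map_sub, evalLin_lin, evalLin_lin, eval_cast, eval_tens, eval_id,
      id_tensor_of_eq_one I.obj_nil]
    simp
  | tens_one f =>
    rw [map_sub, evalLin_lin, evalLin_lin, eval_cast, eval_tens, eval_id,
      tensor_id_of_eq_one I.obj_nil]
    simp
  | rel h => rw [map_sub, hI h, sub_self]

theorem Respects.eval_eq (hI : I.Respects z) {X Y : List Strand} {f g : Diagram aff X Y}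
    (h : DefRel z aff (lin k f) (lin k g)) : I.eval f = I.eval g := by
  rw [← I.evalLin_lin, ← I.evalLin_lin, hI h]

theorem Respects.eval_posLeft_negRight (hI : I.Respects z) :
    I.eval Diagram.posLeft ≫ I.eval Diagram.negRight = 𝟙 (I.obj [dn, up]) :=
  (I.eval_comp Diagram.posLeft Diagram.negRight).symm.trans (hI.eval_eq (.left_right aff))

/-- The value of a morphism of the presented supercategory. -/
def Respects.evalHom (hI : I.Respects z) (X Y : List Strand) :
    HomSpace z aff X Y →ₗ[k] (I.obj X ⟶ I.obj Y) :=
  (vanishing z aff X Y).liftQ (I.evalLin X Y) fun _ h => hI.vanishes h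

theorem Respects.evalHom_cls (hI : I.Respects z) {X Y : List Strand} (f : Diagram aff X Y) :
    hI.evalHom X Y (cls z f) = I.eval f :=
  I.evalLin_lin f

theorem Respects.evalHom_comp (hI : I.Respects z) {X Y Z : List Strand}
    (a : HomSpace z aff X Y) (b : HomSpace z aff Y Z) :
    hI.evalHom X Z (compHom z aff X Y Z a b) = hI.evalHom X Y a ≫ hI.evalHom Y Z b := by
  induction a using hom_induction with
  | h0 => simp only [map_zero, LinearMap.zero_apply, Limits.zero_comp]
  | hadd a b ha hb => simp only [map_add, LinearMap.add_apply, ha, hb, Preadditive.add_comp]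
  | hcls c f =>
    simp only [map_smul, LinearMap.smul_apply, Linear.smul_comp]
    congr 1
    induction b using hom_induction with
    | h0 => simp only [map_zero, Limits.comp_zero]
    | hadd a b ha hb => simp only [map_add, ha, hb, Preadditive.comp_add]
    | hcls c g => simp only [map_smul, compHom_cls, evalHom_cls, Linear.comp_smul, eval_comp]

theorem Respects.evalHom_tens (hI : I.Respects z) {X Y X' Y' : List Strand}
    (a : HomSpace z aff X Y) (b : HomSpace z aff X' Y') :
    hI.evalHom _ _ (tensHom z aff X Y X' Y' a b) = eqToHom (I.obj_append _ _) ≫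
      tensor (k := k) (hI.evalHom X Y a) (hI.evalHom X' Y' b) ≫
        eqToHom (I.obj_append _ _).symm := by
  induction a using hom_induction with
  | h0 => simp only [map_zero, LinearMap.zero_apply, zero_tensor, Limits.zero_comp,
      Limits.comp_zero]
  | hadd a b ha hb => simp only [map_add, LinearMap.add_apply, ha, hb, add_tensor,
      Preadditive.add_comp, Preadditive.comp_add]
  | hcls c f =>
    simp only [map_smul, LinearMap.smul_apply, smul_tensor, Linear.smul_comp, Linear.comp_smul]
    congr 1
    induction b using hom_induction with
    | h0 => simp only [map_zero, tensor_zero, Limits.zero_comp, Limits.comp_zero]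
    | hadd a b ha hb => simp only [map_add, ha, hb, tensor_add, Preadditive.add_comp,
        Preadditive.comp_add]
    | hcls c g => simp only [map_smul, tensHom_cls, evalHom_cls, tensor_smul, Linear.smul_comp,
        Linear.comp_smul, eval_tens]

theorem Respects.evalHom_mem (hI : I.Respects z) {X Y : List Strand} {p : ZMod 2}
    {a : HomSpace z aff X Y} (ha : a ∈ homPart z aff p X Y) :
    hI.evalHom X Y a ∈ Supercategory.part (k := k) p (I.obj X) (I.obj Y) := by
  refine part_induction
    (P := fun a => hI.evalHom X Y a ∈ Supercategory.part (k := k) p (I.obj X) (I.obj Y))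
    ?_ ?_ ?_ ha
  · rw [map_zero]; exact Submodule.zero_mem _
  · intro a b ha hb
    rw [map_add]; exact Submodule.add_mem _ ha hb
  · rintro c f rfl
    rw [map_smul, evalHom_cls]; exact Submodule.smul_mem _ _ (I.eval_mem f)

/-- The monoidal superfunctor determined by an interpretation that respects the relations. -/
def Respects.functor (hI : I.Respects z) : MonoidalSuperfunctor k (Isomeric z aff) B where
  obj X := I.obj X
  map {X Y} f := hI.evalHom X Y f
  map_id X := hI.evalHom_cls (.id X)
  map_comp f g := hI.evalHom_comp f g
  map_add' {X Y} f g := map_add (hI.evalHom X Y) f g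
  map_smul' {X Y} c f := map_smul (hI.evalHom X Y) c f
  map_part h := hI.evalHom_mem h
  obj_one := I.obj_nil
  obj_mul := I.obj_append
  map_tensor f g := hI.evalHom_tens f g

/-! # Comparison of superfunctors with an interpretation -/

variable (I) {C : MonoidalSuperfunctor k (Isomeric z aff) B}
  (hC : ∀ X : List Strand, C.obj (ob z aff X) = I.obj X)

/-- The superfunctor `C` sends the diagram `f` to its value under `I`. -/
def Agrees {X Y : List Strand} (f : Diagram aff X Y) : Prop :=
  eqToHom (hC X).symm ≫ C.map (mor z f) ≫ eqToHom (hC Y) = I.eval f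

variable {I hC}

theorem Agrees.map_eq {X Y : List Strand} {f : Diagram aff X Y} (h : I.Agrees hC f) :
    C.map (mor z f) = eqToHom (hC X) ≫ I.eval f ≫ eqToHom (hC Y).symm := by
  rw [← h]; simp

theorem Agrees.id (X : List Strand) : I.Agrees hC (.id X) := by
  unfold Agrees
  rw [mor_id, C.map_id, eval_id]
  simp

theorem Agrees.comp {X Y Z : List Strand} {f : Diagram aff X Y} {g : Diagram aff Y Z}
    (hf : I.Agrees hC f) (hg : I.Agrees hC g) : I.Agrees hC (.comp f g) := by
  unfold Agrees
  rw [mor_comp, C.map_comp, hf.map_eq, hg.map_eq, eval_comp]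
  simp

theorem Agrees.tens {X Y X' Y' : List Strand} {f : Diagram aff X Y} {g : Diagram aff X' Y'}
    (hf : I.Agrees hC f) (hg : I.Agrees hC g) : I.Agrees hC (.tens f g) := by
  unfold Agrees
  have h := C.map_tensor (mor z f) (mor z g)
  have e : C.map (mor z (Diagram.tens f g)) = _ := (congrArg C.map (mor_tens f g)).trans h
  rw [e, hf.map_eq, hg.map_eq, tensor_eqToHom, eval_tens]
  exact eqToHom_conj₃ _ _ _ _ _ _ _

/-- A functor preserves inverses, so its value on a morphism fixes its value on the inverse. This
handles generators whose images are not prescribed. -/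
theorem Agrees.inv {X Y : List Strand} {f : Diagram aff X Y} {g : Diagram aff Y X}
    (hf : I.Agrees hC f) (hgf : mor z g ≫ mor z f = 𝟙 _) (hfg : I.eval f ≫ I.eval g = 𝟙 _) :
    I.Agrees hC g := by
  have h : C.map (mor z g) ≫ eqToHom (hC X) ≫ I.eval f = eqToHom (hC Y) := by
    have h := C.map_comp (mor z g) (mor z f)
    rw [hgf, C.map_id, hf.map_eq] at h
    have h' := congrArg (· ≫ eqToHom (hC Y)) h
    simpa using h'.symm
  unfold Agrees
  have h' := congrArg (fun a => eqToHom (hC Y).symm ≫ a ≫ I.eval g) h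
  simp only [Category.assoc, hfg, Category.comp_id, eqToHom_trans_assoc, eqToHom_refl,
    Category.id_comp] at h'
  exact h'

theorem agrees_of_gen (hg : ∀ {X Y : List Strand} (g : Gen aff X Y), I.Agrees hC (.gen g))
    {X Y : List Strand} (f : Diagram aff X Y) : I.Agrees hC f := by
  induction f with
  | gen g => exact hg g
  | id X => exact .id X
  | comp f g hf hg => exact hf.comp hg
  | tens f g hf hg => exact hf.tens hg

/-- Diagrams span the morphism spaces and superfunctors are linear, so agreement on diagrams
suffices. -/
theorem map_eq_of_agrees {C' : MonoidalSuperfunctor k (Isomeric z aff) B}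
    {hC' : ∀ X : List Strand, C'.obj (ob z aff X) = I.obj X}
    (h : ∀ {X Y : List Strand} (f : Diagram aff X Y), I.Agrees hC f)
    (h' : ∀ {X Y : List Strand} (f : Diagram aff X Y), I.Agrees hC' f) {X Y : List Strand}
    (a : ob z aff X ⟶ ob z aff Y) :
    C.map a = eqToHom ((hC X).trans (hC' X).symm) ≫ C'.map a ≫
      eqToHom ((hC' Y).trans (hC Y).symm) := by
  refine hom_induction (z := z) (X := X) (Y := Y) (P := fun a : ob z aff X ⟶ ob z aff Y =>
    C.map a = eqToHom ((hC X).trans (hC' X).symm) ≫ C'.map a ≫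
      eqToHom ((hC' Y).trans (hC Y).symm)) ?_ ?_ ?_ a
  · have h0 : ∀ D : MonoidalSuperfunctor k (Isomeric z aff) B,
        D.map (0 : ob z aff X ⟶ ob z aff Y) = 0 := fun D => by
      have h := D.map_smul' (0 : k) (0 : ob z aff X ⟶ ob z aff Y)
      rwa [zero_smul, zero_smul] at h
    refine (h0 C).trans ?_
    refine Eq.trans ?_ (congrArg (fun a => _ ≫ a ≫ _) (h0 C').symm)
    rw [Limits.zero_comp, Limits.comp_zero]
  · intro (a : ob z aff X ⟶ ob z aff Y) (b : ob z aff X ⟶ ob z aff Y) ha hb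
    refine (C.map_add' a b).trans ?_
    refine Eq.trans ?_ (congrArg (fun a => _ ≫ a ≫ _) (C'.map_add' a b).symm)
    rw [Preadditive.add_comp, Preadditive.comp_add, ← ha, ← hb]
  · intro c f
    refine (C.map_smul' c (mor z f)).trans ?_
    refine Eq.trans ?_ (congrArg (fun a => _ ≫ a ≫ _) (C'.map_smul' c (mor z f)).symm)
    rw [Linear.smul_comp, Linear.comp_smul, (h f).map_eq, (h' f).map_eq]
    simp

theorem eq_of_agrees {C' : MonoidalSuperfunctor k (Isomeric z aff) B}
    {hC' : ∀ X : List Strand, C'.obj (ob z aff X) = I.obj X}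
    (h : ∀ {X Y : List Strand} (f : Diagram aff X Y), I.Agrees hC f)
    (h' : ∀ {X Y : List Strand} (f : Diagram aff X Y), I.Agrees hC' f) : C = C' := by
  have e : C.toFunctor = C'.toFunctor :=
    CategoryTheory.Functor.ext (fun X => (hC X).trans (hC' X).symm)
      fun _ _ a => map_eq_of_agrees h h' a
  -- All fields beyond the underlying functor are propositions.
  obtain ⟨⟨F, _, _, _⟩, _, _, _⟩ := C
  obtain ⟨⟨F', _, _, _⟩, _, _, _⟩ := C'
  obtain rfl : F = F' := e
  rfl

end Interpretation

/-! # Diagrams of the quantum isomeric supercategory as affine diagrams -/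

/-- A generator of the quantum isomeric supercategory as a generator of the affine version. -/
def Gen.incl : ∀ {X Y : List Strand}, Gen false X Y → Gen true X Y
  | _, _, .posUp => .posUp
  | _, _, .negUp => .negUp
  | _, _, .negRight => .negRight
  | _, _, .capLeft => .capLeft
  | _, _, .cupLeft => .cupLeft
  | _, _, .token => .token

/-- A diagram of the quantum isomeric supercategory as a diagram of the affine version. -/
def Diagram.incl : ∀ {X Y : List Strand}, Diagram false X Y → Diagram true X Y
  | _, _, .gen g => .gen g.incl
  | _, _, .id X => .id X
  | _, _, .comp f g => .comp f.incl g.incl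
  | _, _, .tens f g => .tens f.incl g.incl

/-! # The superfunctors `X ⊗ -` -/

section TensorLeftFunctor

open StrictMonoidalSupercategory

variable (k : Type u) [CommRing k]
  {A : Type w} [Category.{v} A] [Preadditive A] [Linear k A] [Supercategory k A]

theorem SEnd.ext_of_toFunctor {F G : SEnd k A} (h : F.toFunctor = G.toFunctor) : F = G :=
  Superfunctor.ext (congrArg (fun H : A ⥤ A => H.obj) h) (by
    obtain ⟨F, _, _, _⟩ := F
    obtain ⟨G, _, _, _⟩ := G
    obtain rfl : F = G := h
    rfl)

theorem SEnd.app_eqToHom {F G : SEnd k A} (h : F = G) (Z : A) :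
    SEnd.app (eqToHom h) Z = eqToHom (congrArg (fun H : SEnd k A => H.obj Z) h) := by
  subst h; rfl

variable [Monoid A] [StrictMonoidalSupercategory k A]

/-- Strict unitality and, for products, strict associativity make $X\mapsto X\otimes-$ a monoid
homomorphism on the nose, as an `Interpretation` demands. -/
theorem tensorLeftFunctor_one : tensorLeftFunctor k (1 : A) = 1 :=
  SEnd.ext_of_toFunctor k
    (CategoryTheory.Functor.ext (fun X => one_mul X) fun _ _ f => one_tensor f)

theorem tensorLeftFunctor_mul (X Y : A) :
    tensorLeftFunctor k (X * Y) = tensorLeftFunctor k X * tensorLeftFunctor k Y :=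
  SEnd.ext_of_toFunctor k
    (CategoryTheory.Functor.ext (fun Z => mul_assoc X Y Z) fun Z W f => by
      change tensor (k := k) (𝟙 (X * Y)) f =
        eqToHom _ ≫ tensor (k := k) (𝟙 X) (tensor (k := k) (𝟙 Y) f) ≫ eqToHom _
      rw [← tensor_id (k := k), tensor_assoc])

end TensorLeftFunctor

/-! # The interpretation that defines the collapsing superfunctor -/

namespace Isomeric

open Diagram StrictMonoidalSupercategory

variable {k : Type u} [CommRing k]

/-- The collapsed open Clifford token as a supernatural transformation. -/
def otokNat (z : k) : tensorLeftFunctor k (ob z false [up]) ⟶ tensorLeftFunctor k (ob z false [up]) :=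
  ⟨fun Z => otok (z := z) Z, supernatPart_le 1 ⟨fun Z => hasParity_otok (z := z) Z,
    fun q X Y _ hf => otok_naturality (z := z) (X := X) (Y := Y) (q := q) hf⟩⟩

/-- The image of a generating morphism under the collapsing superfunctor. -/
def collapseGen (z : k) : ∀ {X Y : List Strand}, Gen true X Y →
    (tensorLeftFunctor k (ob z false X) ⟶ tensorLeftFunctor k (ob z false Y))
  | _, _, .posUp => tensorLeftMap k (mor z posUp)
  | _, _, .negUp => tensorLeftMap k (mor z negUp)
  | _, _, .negRight => tensorLeftMap k (mor z negRight)
  | _, _, .capLeft => tensorLeftMap k (mor z capLeft)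
  | _, _, .cupLeft => tensorLeftMap k (mor z cupLeft)
  | _, _, .token => tensorLeftMap k (mor z token)
  | _, _, .openToken _ => otokNat z

theorem otokNat_mem (z : k) :
    otokNat z ∈ Supercategory.part (k := k) 1 (tensorLeftFunctor k (ob z false [up]))
      (tensorLeftFunctor k (ob z false [up])) :=
  ⟨fun Z => hasParity_otok (z := z) Z,
    fun q X Y _ hf => otok_naturality (z := z) (X := X) (Y := Y) (q := q) hf⟩

theorem tensorLeftMap_mor_mem {z : k} {X Y : List Strand} {p : ZMod 2} {f : Diagram false X Y}
    (h : f.parity = p) :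
    tensorLeftMap k (mor z f) ∈ Supercategory.part (k := k) p
      (tensorLeftFunctor k (ob z false X)) (tensorLeftFunctor k (ob z false Y)) :=
  tensorLeft_mem_supernatPart k (f := mor z f)
    (show mor z f ∈ Supercategory.part (k := k) p (ob z false X) (ob z false Y) from cls_mem h)

/-- The images of the objects and of the generating morphisms under the collapsing superfunctor. -/
def collapse (z : k) : Interpretation k true (SEnd k (QuantumIsomeric z)) where
  obj X := tensorLeftFunctor k (ob z false X)
  obj_nil := tensorLeftFunctor_one k
  obj_append X Y := tensorLeftFunctor_mul k (ob z false X) (ob z false Y)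
  gen := collapseGen z
  gen_mem g := by
    cases g with
    | openToken h => exact otokNat_mem z
    | _ => exact tensorLeftMap_mor_mem rfl

/-- The components of the value of a diagram. -/
def collapseApp (z : k) {X Y : List Strand} (f : Diagram true X Y) (Z : List Strand) :
    ob z false (X ++ Z) ⟶ ob z false (Y ++ Z) :=
  SEnd.app ((collapse z).eval f) (ob z false Z)

variable {z : k}

theorem collapse_eval_ext {X Y : List Strand}
    {α β : (collapse z).obj X ⟶ (collapse z).obj Y}
    (h : ∀ Z : List Strand, SEnd.app α (ob z false Z) = SEnd.app β (ob z false Z)) : α = β :=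
  Subtype.ext (funext h)

theorem collapseApp_comp {X Y W : List Strand} (f : Diagram true X Y) (g : Diagram true Y W)
    (Z : List Strand) : collapseApp z (.comp f g) Z = collapseApp z f Z ≫ collapseApp z g Z := rfl

/-- Horizontal composition of transformations applies the right factor first, whiskered by
$X\otimes-$, and then the left factor at the shifted object `Y' ++ Z`. The outer factors are the
components of the associativity identifications. -/
theorem collapseApp_tens {X Y X' Y' : List Strand} (f : Diagram true X Y)
    (g : Diagram true X' Y') (Z : List Strand) :
    collapseApp z (.tens f g) Z =
      eqToHom (congrArg (ob z false) (List.append_assoc X X' Z)) ≫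
        (tm (𝟙 (ob z false X)) (collapseApp z g Z) ≫ collapseApp z f (Y' ++ Z)) ≫
          eqToHom (congrArg (ob z false) (List.append_assoc Y Y' Z).symm) := by
  have h : SEnd.app ((collapse z).eval (.tens f g)) (ob z false Z) =
      SEnd.app (eqToHom ((collapse z).obj_append X X')) (ob z false Z) ≫
        (tm (𝟙 (ob z false X)) (collapseApp z g Z) ≫ collapseApp z f (Y' ++ Z)) ≫
          SEnd.app (eqToHom ((collapse z).obj_append Y Y').symm) (ob z false Z) := rfl
  rw [SEnd.app_eqToHom, SEnd.app_eqToHom] at h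
  exact h

/-- Both sides are compatible with composition and tensor product and agree on generators. This
transfers the relations of the quantum isomeric supercategory to the images. -/
theorem collapseApp_incl {X Y : List Strand} (f : Diagram false X Y) :
    ∀ Z : List Strand, collapseApp z f.incl Z = tm (mor z f) (𝟙 (ob z false Z)) := by
  induction f with
  | gen g =>
    intro Z
    cases g with
    | openToken h => exact absurd h Bool.false_ne_true
    | _ => rfl
  | id X => exact fun Z => (tm_id X Z).symm
  | comp f g hf hg =>
    intro Z
    rw [mor_comp, comp_tm_id, ← hf, ← hg]
    rfl
  | tens f g hf hg =>
    intro Z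
    refine (collapseApp_tens f.incl g.incl Z).trans ?_
    rw [hf, hg, id_tm_comp_tm_id, mor_tens]
    exact (tensor_assoc (k := k) (mor z f) (mor z g) (𝟙 (ob z false Z))).symm

/-- The components of the value of a linear combination of diagrams. -/
def collapseLin (z : k) (X Y : List Strand) (Z : List Strand) :
    LinDiagram k true X Y →ₗ[k] (ob z false (X ++ Z) ⟶ ob z false (Y ++ Z)) where
  toFun l := SEnd.app ((collapse z).evalLin X Y l) (ob z false Z)
  map_add' l m := by rw [map_add]; rfl
  map_smul' c l := by rw [map_smul]; rfl

theorem collapseLin_lin {X Y : List Strand} (f : Diagram true X Y) (Z : List Strand) :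
    collapseLin z X Y Z (lin k f) = collapseApp z f Z :=
  congrArg (fun α => SEnd.app α (ob z false Z)) ((collapse z).evalLin_lin f)

theorem collapseLin_incl {X Y : List Strand} (l : LinDiagram k false X Y) (Z : List Strand) :
    collapseLin z X Y Z (l.mapDomain Diagram.incl) =
      tm ((vanishing z false X Y).mkQ l : ob z false X ⟶ ob z false Y) (𝟙 (ob z false Z)) := by
  induction l using lin_induction with
  | h0 => rw [Finsupp.mapDomain_zero, map_zero, map_zero]; exact (tm_zero_left _).symm
  | hadd l m hl hm =>
    rw [Finsupp.mapDomain_add, map_add, map_add, hl, hm]; exact (tm_add_left _ _ _).symm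
  | hlin c f =>
    rw [Finsupp.mapDomain_smul, Finsupp.mapDomain_single, map_smul, map_smul, collapseLin_lin,
      collapseApp_incl]
    exact (tm_smul_left c (mor z f) _).symm

/-! ### The defining relations, component by component -/

theorem collapseLin_eq_of_defRel {X Y : List Strand} {l r : LinDiagram k false X Y}
    (h : DefRel z false l r) (Z : List Strand) :
    collapseLin z X Y Z (l.mapDomain Diagram.incl) =
      collapseLin z X Y Z (r.mapDomain Diagram.incl) := by
  rw [collapseLin_incl, collapseLin_incl]
  exact congrArg (fun f : ob z false X ⟶ ob z false Y => tm f (𝟙 (ob z false Z)))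
    ((Submodule.Quotient.eq (vanishing z false X Y)).2 (.rel h))

theorem collapseLin_lin_eq {X Y : List Strand} {f g : Diagram false X Y}
    (h : DefRel z false (lin k f) (lin k g)) (Z : List Strand) :
    collapseLin z X Y Z (lin k f.incl) = collapseLin z X Y Z (lin k g.incl) := by
  have h := collapseLin_eq_of_defRel h Z
  rwa [Finsupp.mapDomain_single, Finsupp.mapDomain_single] at h

theorem collapseLin_lin_eq_zero {X Y : List Strand} {f : Diagram false X Y}
    (h : DefRel z false (lin k f) 0) (Z : List Strand) :
    collapseLin z X Y Z (lin k f.incl) = collapseLin z X Y Z 0 := by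
  have h := collapseLin_eq_of_defRel h Z
  rwa [Finsupp.mapDomain_single, Finsupp.mapDomain_zero] at h

/-- The words involved are literal, so the transports in `collapseApp_tens` are identities and can
be stripped; the content is `otok_box_posUp`. -/
theorem collapseLin_open_under (Z : List Strand) :
    collapseLin z [up, up] [up, up] Z
        (lin k (comp (tens (Diagram.id [up]) openToken :) posUp)) =
      collapseLin z [up, up] [up, up] Z
        (lin k (comp posUp (tens openToken (Diagram.id [up]) :))) := by
  rw [collapseLin_lin, collapseLin_lin, collapseApp_comp, collapseApp_comp, collapseApp_tens,
    collapseApp_tens]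
  have h : tm (𝟙 (ob z false [up])) (collapseApp z openToken Z) ≫
      collapseApp z (Diagram.id [up]) (up :: Z) = wl up (otok Z) := Category.comp_id _
  have h' : tm (𝟙 (ob z false [up])) (collapseApp z (Diagram.id [up]) Z) ≫
      collapseApp z openToken (up :: Z) = otok (up :: Z) :=
    (congrArg (· ≫ _) (tm_id [up] (up :: Z))).trans (Category.id_comp _)
  refine Eq.trans ?_ ((otok_box_posUp Z).trans ?_)
  · refine congrArg (· ≫ box (mor z posUp) Z) (Eq.trans ?_ h)
    exact (Category.id_comp _).trans (Category.comp_id _)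
  · refine congrArg (box (mor z posUp) Z ≫ ·) (Eq.trans h'.symm ?_)
    exact ((Category.id_comp _).trans (Category.comp_id _)).symm

theorem collapseLin_open_bubble (Z : List Strand) :
    collapseLin z [] [] Z
        (lin k (comp cupLeft (comp (tens openToken (Diagram.id [dn]) :) capRight))) =
      collapseLin z [] [] Z 0 := by
  rw [collapseLin_lin, map_zero, collapseApp_comp, collapseApp_comp, collapseApp_tens]
  have h' : tm (𝟙 (ob z false [up])) (collapseApp z (Diagram.id [dn]) Z) ≫
      collapseApp z openToken (dn :: Z) = otok (dn :: Z) :=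
    (congrArg (· ≫ _) (tm_id [up] (dn :: Z))).trans (Category.id_comp _)
  refine Eq.trans ?_ (otok_bubble Z)
  refine congrArg (fun f => cup Z ≫ f ≫ box (mor z negRight) Z ≫ cap Z) (Eq.trans ?_ h')
  exact (Category.id_comp _).trans (Category.comp_id _)

/-- A relation without open tokens is the inclusion of the same relation of the quantum isomeric
supercategory, so it holds after tensoring with any identity. The three open token relations are
those proved for `otok`. -/
theorem collapse_respects : (collapse z).Respects z := by
  intro X Y l r h
  refine collapse_eval_ext fun Z => ?_
  change collapseLin z X Y Z l = collapseLin z X Y Z r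
  cases h with
  | pos_neg =>
    have h := collapseLin_lin_eq (z := z) (.pos_neg false) Z
    simp only [Diagram.incl, Gen.incl] at h
    exact h
  | neg_pos =>
    have h := collapseLin_lin_eq (z := z) (.neg_pos false) Z
    simp only [Diagram.incl, Gen.incl] at h
    exact h
  | right_left =>
    have h := collapseLin_lin_eq (z := z) (.right_left false) Z
    simp only [Diagram.incl, Gen.incl] at h
    exact h
  | left_right =>
    have h := collapseLin_lin_eq (z := z) (.left_right false) Z
    simp only [Diagram.incl, Gen.incl] at h
    exact h
  | braid =>
    have h := collapseLin_lin_eq (z := z) (.braid false) Z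
    simp only [Diagram.incl, Gen.incl] at h
    exact h
  | skein =>
    have h := collapseLin_eq_of_defRel (z := z) (.skein false) Z
    -- The difference is rewritten as a sum with a multiple by $-1$ so that linearity of `mapDomain`
    -- applies.
    rw [sub_eq_add_neg, ← neg_one_smul k, Finsupp.mapDomain_add, Finsupp.mapDomain_smul,
      Finsupp.mapDomain_smul, neg_one_smul, ← sub_eq_add_neg, Finsupp.mapDomain_single,
      Finsupp.mapDomain_single, Finsupp.mapDomain_single] at h
    simp only [Diagram.incl, Gen.incl] at h
    exact h
  | token_sq =>
    have h := collapseLin_eq_of_defRel (z := z) (.token_sq false) Z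
    rw [← neg_one_smul k, Finsupp.mapDomain_smul, neg_one_smul, Finsupp.mapDomain_single,
      Finsupp.mapDomain_single] at h
    simp only [Diagram.incl, Gen.incl] at h
    exact h
  | token_over =>
    have h := collapseLin_lin_eq (z := z) (.token_over false) Z
    simp only [Diagram.incl, Gen.incl] at h
    exact h
  | token_bubble =>
    have h := collapseLin_lin_eq_zero (z := z) (.token_bubble false) Z
    simp only [Diagram.incl, Gen.incl] at h
    exact h
  | bubble =>
    have h := collapseLin_lin_eq_zero (z := z) (.bubble false) Z
    simp only [Diagram.incl, Gen.incl] at h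
    exact h
  | zigzag_up =>
    have h := collapseLin_lin_eq (z := z) (.zigzag_up false) Z
    simp only [Diagram.incl, Gen.incl] at h
    exact h
  | zigzag_dn =>
    have h := collapseLin_lin_eq (z := z) (.zigzag_dn false) Z
    simp only [Diagram.incl, Gen.incl] at h
    exact h
  | open_sq =>
    rw [map_neg, collapseLin_lin, collapseLin_lin]
    exact otok_sq Z
  | open_under => exact collapseLin_open_under Z
  | open_bubble => exact collapseLin_open_bubble Z

/-! # Existence and uniqueness of the collapsing superfunctor -/

/-- The collapsing superfunctor. -/
def collapseFunctor (z : k) : AffineAction z := (collapse_respects (z := z)).functor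

theorem collapseFunctor_actsOnObjects : ActsOnObjects (collapseFunctor z) := fun _ => rfl

theorem collapseImage_collapseFunctor {X Y : List Strand} (f : ob z true X ⟶ ob z true Y) :
    collapseImage collapseFunctor_actsOnObjects f =
      (collapse_respects (z := z)).evalHom X Y f :=
  (Category.id_comp _).trans (Category.comp_id _)

theorem collapseFunctor_isCollapsing : IsCollapsing (collapseFunctor z) where
  onObjects := collapseFunctor_actsOnObjects
  posUp := (collapseImage_collapseFunctor _).trans (collapse_respects.evalHom_cls posUp)
  negUp := (collapseImage_collapseFunctor _).trans (collapse_respects.evalHom_cls negUp)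
  capLeft := (collapseImage_collapseFunctor _).trans (collapse_respects.evalHom_cls capLeft)
  cupLeft := (collapseImage_collapseFunctor _).trans (collapse_respects.evalHom_cls cupLeft)
  token := (collapseImage_collapseFunctor _).trans (collapse_respects.evalHom_cls token)
  openToken X := congrArg (fun α => SEnd.app α (ob z false X))
    ((collapseImage_collapseFunctor _).trans (collapse_respects.evalHom_cls openToken))
  posRight := by
    refine (collapseImage_collapseFunctor _).trans ?_
    have h : (collapse_respects (z := z)).evalHom [up, dn] [dn, up] (posRight z true) =
        (collapse z).eval negRight +
          z • ((collapse z).eval capRight ≫ (collapse z).eval cupRight) := by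
      rw [posRight]
      refine (map_add (collapse_respects.evalHom [up, dn] [dn, up]) _ _).trans ?_
      refine congrArg₂ (· + ·) (collapse_respects.evalHom_cls negRight) ?_
      refine (map_smul (collapse_respects.evalHom [up, dn] [dn, up]) z _).trans ?_
      refine congrArg (z • ·) ((collapse_respects.evalHom_comp _ _).trans ?_)
      exact congrArg₂ (· ≫ ·) (collapse_respects.evalHom_cls capRight)
        (collapse_respects.evalHom_cls cupRight)
    refine h.trans (collapse_eval_ext fun Z => ?_)
    refine Eq.trans ?_ (box_posRight Z).symm
    -- Both sides contain the same four factors in the correction term, bracketed differently.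
    exact congrArg (fun f => box (mor z negRight) Z + z • f) (Category.assoc _ _ _)

/-! ### Uniqueness: agreement on all diagrams -/

theorem agrees_posLeft {C : AffineAction z}
    {hC : ∀ X : List Strand, C.obj (ob z true X) = (collapse z).obj X}
    (hp : (collapse z).Agrees hC posUp) (hcap : (collapse z).Agrees hC capLeft)
    (hcup : (collapse z).Agrees hC cupLeft) : (collapse z).Agrees hC posLeft :=
  .comp (.tens (.id [dn, up]) hcup)
    (.comp (.tens (.id [dn]) (.tens hp (.id [dn]))) (.tens hcap (.id [up, dn])))

/-- $R^-$ is the inverse of $L^+$, whose image is determined by those of $P$, $\varepsilon$ and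
$\eta$. -/
theorem agrees_negRight {C : AffineAction z}
    {hC : ∀ X : List Strand, C.obj (ob z true X) = (collapse z).obj X}
    (hl : (collapse z).Agrees hC posLeft) : (collapse z).Agrees hC negRight :=
  hl.inv negRight_posLeft collapse_respects.eval_posLeft_negRight

theorem IsCollapsing.agrees {C : AffineAction z} (hC : IsCollapsing C) {X Y : List Strand}
    (f : Diagram true X Y) : (collapse z).Agrees hC.onObjects f := by
  refine Interpretation.agrees_of_gen (fun g => ?_) f
  cases g with
  | posUp => exact hC.posUp
  | negUp => exact hC.negUp
  | capLeft => exact hC.capLeft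
  | cupLeft => exact hC.cupLeft
  | token => exact hC.token
  | openToken h => exact collapse_eval_ext hC.openToken
  | negRight => exact agrees_negRight (agrees_posLeft hC.posUp hC.capLeft hC.cupLeft)

end Isomeric

end

theorem mainTheorem7 {k : Type*} [CommRing k] (hk : ringChar k ≠ 2) (z : k) :
    (∃! C : AffineAction z, IsCollapsing C) ∧
      ∀ (C : AffineAction z) (hC : IsCollapsing C),
        collapseImage hC.onObjects (Isomeric.mor z Diagram.negRight) =
          tensorLeftMap k (Isomeric.mor z Diagram.negRight) :=
  ⟨⟨Isomeric.collapseFunctor z, Isomeric.collapseFunctor_isCollapsing, fun _ hC =>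
      Interpretation.eq_of_agrees (Isomeric.IsCollapsing.agrees hC)
        (Isomeric.IsCollapsing.agrees Isomeric.collapseFunctor_isCollapsing)⟩,
    fun _ hC => Isomeric.IsCollapsing.agrees hC Diagram.negRight⟩
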